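/- **Definitions.** All spaces are Hausdorff, and $\mathbb{T}$ is the circle group. A *system* $(X,s)$ is a compact space $X$ with a homeomorphism $s\colon X\to X$. It is *minimal* if $X\neq\emptyset$ and the only non-empty closed $A\subseteq X$ with $s(A)=A$ is $A=X$. A system $(Y,t)$ is a *factor* of $(X,s)$ if there is a continuous surjection $\pi\colon X\to Y$ with $\pi\circ s=t\circ\pi$. The *enveloping semigroup* $E(X,s)$ (also called the Ellis group when $(X,s)$ is distal) is the closure of $\{s^n : n\in\mathbb{Z}\}$ in the product space $X^X$, and $(E(X,s),\lambda_s)$ is the system given by $\lambda_s(a)=s\circ a$. Let $G_0(X,s)$ be the set of constant functions $X\to\mathbb{T}$, and let $G_{m+1}(X,s)$ be the set of continuous $g\colon X\to\mathbb{T}$ with $g\circ s=f\cdot g$ for some $f\in G_m(X,s)$. The system $(X,s)$ has *quasi-discrete spectrum* if the linear span of $\bigcup_{m\ge 0}G_m(X,s)$ is dense in $C(X)=C(X,\mathbb{C})$. Let $H(\mathbb{T})$ be the group of all (not necessarily continuous) homomorphisms $\mathbb{T}\to\mathbb{T}$ under pointwise multiplication, with the topology of pointwise convergence. Let $\mathcal{H}\subseteq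 H(\mathbb{T})^{\{0,1,2,\dots\}}$ be the set of sequences $(\phi_k)_{k\ge 0}$ with $\phi_0=\mathrm{id}_{\mathbb{T}}$ and $$\phi_k(x^{k!})=\prod_{j=1}^{k}\phi_1^{(j)}\bigl(x^{s(k,j)}\bigr)\qquad\text{for all } k\ge 1 \text{ and all roots of unity } x\in\mathbb{T},$$ where $\phi_1^{(j)}$ is the $j$-fold composition of $\phi_1$ and the Stirling numbers $s(k,j)\in\mathbb{Z}$ are given by $n(n-1)\cdots(n-k+1)=\sum_{j=0}^{k}s(k,j)n^j$. The map $T(\phi_0,\phi_1,\phi_2,\dots)=(\phi_0,\phi_0\phi_1,\phi_1\phi_2,\dots)$ is a homeomorphism of $\mathcal{H}$ onto itself. **Theorem.** Let $(X,s)$ be a system. 1. If $(X,s)$ is a factor of $(\mathcal{H},T)$, then $(E(X,s),\lambda_s)$ has quasi-discrete spectrum. 2. If $(X,s)$ is minimal, then $(X,s)$ is a factor of $(\mathcal{H},T)$ if and only if $(E(X,s),\lambda_s)$ has quasi-discrete spectrum. -/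

import Mathlib

namespace QDS

/-! ### Dynamical systems

A system is a compact Hausdorff space `X` with a homeomorphism `s : X ≃ₜ X`. -/

section Systems

universe u v

variable {X : Type u} {Y : Type v} [TopologicalSpace X] [TopologicalSpace Y]

/-- `(X, s)` is minimal: `X` is non-empty and has no proper, non-empty, closed set `A` with `s(A) = A`. -/
def IsMinimal (s : X ≃ₜ X) : Prop :=
  Nonempty X ∧ ∀ A : Set X, IsClosed A → A.Nonempty → s '' A = A → A = Set.univ

/-- `(Y, t)` is a factor of `(X, s)`: there is a continuous surjection `π : X → Y` with
`π ∘ s = t ∘ π`. -/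
def IsFactor (t : Y ≃ₜ Y) (s : X ≃ₜ X) : Prop :=
  ∃ π : X → Y, Continuous π ∧ Function.Surjective π ∧ ∀ x, π (s x) = t (π x)

/-- The enveloping semigroup `E(X, s)`: the closure of `{sⁿ : n ∈ ℤ}` in the product space
`X → X`. -/
def envelopingSemigroup (s : X ≃ₜ X) : Set (X → X) :=
  closure (Set.range fun n : ℤ => ((s ^ n : X ≃ₜ X) : X → X))

theorem comp_mem_envelopingSemigroup (s : X ≃ₜ X) (m : ℤ) {a : X → X}
    (ha : a ∈ envelopingSemigroup s) :
    ((s ^ m : X ≃ₜ X) : X → X) ∘ a ∈ envelopingSemigroup s := by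
  have hc : Continuous fun b : X → X => ((s ^ m : X ≃ₜ X) : X → X) ∘ b :=
    continuous_pi fun x => (s ^ m : X ≃ₜ X).continuous.comp (continuous_apply x)
  refine map_mem_closure hc ha ?_
  rintro _ ⟨n, rfl⟩
  exact ⟨m + n, by funext x; simp [zpow_add]⟩

theorem symm_comp_mem_envelopingSemigroup (s : X ≃ₜ X) {a : X → X}
    (ha : a ∈ envelopingSemigroup s) : s.symm ∘ a ∈ envelopingSemigroup s := by
  have h := comp_mem_envelopingSemigroup s (-1) ha
  rw [zpow_neg_one] at h
  exact h

theorem self_comp_mem_envelopingSemigroup (s : X ≃ₜ X) {a : X → X}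
    (ha : a ∈ envelopingSemigroup s) : s ∘ a ∈ envelopingSemigroup s := by
  have h := comp_mem_envelopingSemigroup s 1 ha
  rw [zpow_one] at h
  exact h

/-- Left translation `λ_s : a ↦ s ∘ a` on the enveloping semigroup `E(X, s)`. -/
def envelopingTranslation (s : X ≃ₜ X) : envelopingSemigroup s ≃ₜ envelopingSemigroup s where
  toFun a := ⟨s ∘ a.1, self_comp_mem_envelopingSemigroup s a.2⟩
  invFun a := ⟨s.symm ∘ a.1, symm_comp_mem_envelopingSemigroup s a.2⟩
  left_inv a := by ext x; simp
  right_inv a := by ext x; simp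
  continuous_toFun := Continuous.subtype_mk
    (continuous_pi fun x => s.continuous.comp
      ((continuous_apply x).comp continuous_subtype_val)) fun a =>
        self_comp_mem_envelopingSemigroup s a.2
  continuous_invFun := Continuous.subtype_mk
    (continuous_pi fun x => s.symm.continuous.comp
      ((continuous_apply x).comp continuous_subtype_val)) fun a =>
        symm_comp_mem_envelopingSemigroup s a.2

/-- The sets `G_m(X, s)` of continuous functions `X → 𝕋`: `G_0` consists of the constant
functions, and `g ∈ G_{m+1}` iff `g ∘ s = f g` for some `f ∈ G_m`. -/
def quasiEigenfunctions (s : X ≃ₜ X) : ℕ → Set C(X, Circle)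
  | 0 => {g | ∃ c : Circle, ∀ x, g x = c}
  | m + 1 => {g | ∃ f ∈ quasiEigenfunctions s m, ∀ x, g (s x) = f x * g x}

/-- `(X, s)` has (topological) quasi-discrete spectrum: the linear span of the
quasi-eigenfunctions is dense in `C(X)`. -/
def HasQuasiDiscreteSpectrum (s : X ≃ₜ X) : Prop :=
  Dense (Submodule.span ℂ {F : C(X, ℂ) | ∃ m : ℕ, ∃ g ∈ quasiEigenfunctions s m,
    ∀ x, F x = (g x : ℂ)} : Set C(X, ℂ))

end Systems

/-! ### The system `(𝓗, T)` -/

/-- The group `H(𝕋)` of all (not necessarily continuous) endomorphisms of the circle group carries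
the topology of pointwise convergence. -/
noncomputable instance endCircleTopology : TopologicalSpace (Circle →* Circle) :=
  TopologicalSpace.induced (fun φ => (φ : Circle → Circle)) inferInstance

instance : IsTopologicalGroup (Circle →* Circle) :=
  topologicalGroup_induced (MonoidHom.coeFn Circle Circle)

section Shift

variable {G : Type*} [CommGroup G]

/-- `A_G (g₀, g₁, g₂, …) = (g₀, g₀ g₁, g₁ g₂, …)`. -/
def shiftMul (g : ℕ → G) : ℕ → G
  | 0 => g 0
  | k + 1 => g k * g (k + 1)

/-- The inverse of `shiftMul`. -/
def shiftMulInv (g : ℕ → G) : ℕ → G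
  | 0 => g 0
  | k + 1 => (shiftMulInv g k)⁻¹ * g (k + 1)

/-- `A_G` as a homeomorphism of `G^ℕ`. -/
def shiftMulHomeo [TopologicalSpace G] [IsTopologicalGroup G] : (ℕ → G) ≃ₜ (ℕ → G) where
  toFun := shiftMul
  invFun := shiftMulInv
  left_inv g := by
    funext k
    induction k with
    | zero => rfl
    | succ k ih => simp [shiftMulInv, ih, shiftMul]
  right_inv g := by
    funext k
    cases k with
    | zero => rfl
    | succ k => simp [shiftMulInv, shiftMul]
  continuous_toFun := by
    refine continuous_pi fun k => ?_
    cases k with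
    | zero => exact continuous_apply 0
    | succ k => exact (continuous_apply k).mul (continuous_apply (k + 1))
  continuous_invFun := by
    refine continuous_pi fun k => ?_
    induction k with
    | zero => exact continuous_apply 0
    | succ k ih => exact ih.inv.mul (continuous_apply (k + 1))

end Shift

/-- The signed Stirling numbers of the first kind:
`n (n - 1) ⋯ (n - k + 1) = ∑ j, s(k, j) n ^ j`. -/
noncomputable def stirling (k j : ℕ) : ℤ := (descPochhammer ℤ k).coeff j

/-- The space `𝓗` of the sequences `(φ_k)` in `H(𝕋)` with `φ_0 = id` and
`φ_k (x ^ k!) = ∏_{j = 1}^k φ_1^{(j)} (x ^ s(k, j))` for all `k ≥ 1` and all roots of unity `x`,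
where `φ_1^{(j)}` is the `j`-fold composition of `φ_1`. -/
def calH : Set (ℕ → (Circle →* Circle)) :=
  {φ | φ 0 = MonoidHom.id Circle ∧
    ∀ k : ℕ, 1 ≤ k → ∀ x ∈ CommGroup.torsion Circle,
      φ k (x ^ k.factorial) = ∏ j ∈ Finset.Icc 1 k, (φ 1)^[j] (x ^ stirling k j)}

theorem exists_apply_eq_zpow (φ : Circle →* Circle) {x : Circle}
    (hx : x ∈ CommGroup.torsion Circle) : ∃ m : ℤ, φ x = x ^ m := by
  have hx' : IsOfFinOrder x := hx
  have hp : IsPrimitiveRoot (x : ℂ) (orderOf x) :=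
    (IsPrimitiveRoot.orderOf x).map_of_injective (f := Circle.coeHom) Circle.coe_injective
  have : NeZero (orderOf x) := ⟨hx'.orderOf_pos.ne'⟩
  obtain ⟨i, -, hi⟩ := hp.eq_pow_of_pow_eq_one (ξ := ((φ x : Circle) : ℂ)) (by
    rw [← Circle.coe_pow, ← map_pow, pow_orderOf_eq_one, map_one, Circle.coe_one])
  refine ⟨i, ?_⟩
  rw [zpow_natCast]
  exact Circle.coe_injective (by rw [← hi, Circle.coe_pow])

theorem prod_iterate_stirling (φ : Circle →* Circle) {x : Circle} {m : ℤ} (h : φ x = x ^ m)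
    {k : ℕ} (hk : 1 ≤ k) :
    ∏ j ∈ Finset.Icc 1 k, φ^[j] (x ^ stirling k j) = x ^ (descPochhammer ℤ k).eval m := by
  have hit : ∀ (j : ℕ) (a : ℤ), φ^[j] (x ^ a) = x ^ (a * m ^ j) := by
    intro j
    induction j with
    | zero => intro a; simp
    | succ j ih =>
      intro a
      rw [Function.iterate_succ_apply', ih, map_zpow, h, ← zpow_mul]
      congr 1
      ring
  have h0 : (descPochhammer ℤ k).coeff 0 = 0 := by
    rw [Polynomial.coeff_zero_eq_eval_zero]
    exact descPochhammer_ne_zero_eval_zero ℤ (by omega)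
  have hd : (descPochhammer ℤ k).natDegree < k + 1 := by
    rw [descPochhammer_natDegree]; omega
  have hI : Finset.Icc 1 k = Finset.Ico 1 (k + 1) := by ext; simp
  rw [Polynomial.eval_eq_sum_range' hd, Finset.sum_range_succ', h0, zero_mul, add_zero, hI,
    Finset.prod_Ico_eq_prod_range]
  have hz : ∀ (f : ℕ → ℤ) (n : ℕ),
      x ^ (∑ i ∈ Finset.range n, f i) = ∏ i ∈ Finset.range n, x ^ f i := by
    intro f n
    induction n with
    | zero => simp
    | succ n ih => rw [Finset.sum_range_succ, Finset.prod_range_succ, zpow_add, ih]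
  rw [hz]
  refine Finset.prod_congr (by simp) fun i _ => ?_
  rw [hit, stirling, add_comm 1 i]

theorem descPochhammer_eval_add_one (k : ℕ) (m : ℤ) :
    (descPochhammer ℤ (k + 1)).eval (m + 1) =
      (descPochhammer ℤ (k + 1)).eval m + (k + 1) * (descPochhammer ℤ k).eval m := by
  have h1 : (descPochhammer ℤ (k + 1)).eval (m + 1) = (m + 1) * (descPochhammer ℤ k).eval m := by
    rw [descPochhammer_succ_left]
    simp [Polynomial.eval_comp]
  rw [h1, descPochhammer_succ_eval]
  ring

theorem mem_calH_iff (φ : ℕ → (Circle →* Circle)) :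
    φ ∈ calH ↔ φ 0 = MonoidHom.id Circle ∧
      ∀ (k : ℕ) (x : Circle) (m : ℤ), x ∈ CommGroup.torsion Circle → φ 1 x = x ^ m →
        φ k (x ^ k.factorial) = x ^ (descPochhammer ℤ k).eval m := by
  constructor
  · rintro ⟨h0, h⟩
    refine ⟨h0, fun k x m hx hm => ?_⟩
    rcases Nat.eq_zero_or_pos k with rfl | hk
    · simp [h0]
    · rw [h k hk x hx, prod_iterate_stirling _ hm hk]
  · rintro ⟨h0, h⟩
    refine ⟨h0, fun k hk x hx => ?_⟩
    obtain ⟨m, hm⟩ := exists_apply_eq_zpow (φ 1) hx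
    rw [h k x m hx hm, prod_iterate_stirling _ hm hk]

theorem mem_calH_iff_shiftMul_mem (φ : ℕ → (Circle →* Circle)) :
    φ ∈ calH ↔ shiftMul φ ∈ calH := by
  rw [mem_calH_iff, mem_calH_iff]
  have hfac : ∀ (k : ℕ) (x : Circle), x ^ (k + 1).factorial = (x ^ (k + 1)) ^ k.factorial := by
    intro k x
    rw [← pow_mul, Nat.factorial_succ]
  have hpow : ∀ (k : ℕ) (x : Circle) (m : ℤ), φ 1 x = x ^ m →
      φ 1 (x ^ (k + 1)) = (x ^ (k + 1)) ^ m := by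
    intro k x m hm
    rw [map_pow, hm, ← zpow_natCast, ← zpow_natCast, ← zpow_mul, ← zpow_mul, mul_comm]
  have hz : ∀ (k : ℕ) (x : Circle) (a b : ℤ),
      (x ^ (k + 1)) ^ a * x ^ b = x ^ (b + (k + 1) * a) := by
    intro k x a b
    rw [← zpow_natCast, ← zpow_mul, ← zpow_add]
    congr 1
    push_cast
    ring
  constructor
  · rintro ⟨h0, h⟩
    refine ⟨h0, fun k x m hx hm => ?_⟩
    have hm' : φ 1 x = x ^ (m - 1) := by
      have : φ 0 x * φ 1 x = x ^ m := hm
      rw [h0, MonoidHom.id_apply] at this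
      rw [zpow_sub_one, ← this]
      simp
    cases k with
    | zero => simp [shiftMul, h0]
    | succ k =>
      have h1 := h k (x ^ (k + 1)) (m - 1) (pow_mem hx _) (hpow k x _ hm')
      have h2 := h (k + 1) x (m - 1) hx hm'
      have h3 := descPochhammer_eval_add_one k (m - 1)
      rw [sub_add_cancel] at h3
      rw [shiftMul, MonoidHom.mul_apply, h2, hfac, h1, hz, h3]
  · rintro ⟨h0, h⟩
    have h0' : φ 0 = MonoidHom.id Circle := h0
    refine ⟨h0', fun k => ?_⟩
    induction k with
    | zero => intro x m hx hm; simp [h0']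
    | succ k ih =>
      intro x m hx hm
      have hm' : shiftMul φ 1 x = x ^ (m + 1) := by
        rw [shiftMul, MonoidHom.mul_apply, h0', hm, MonoidHom.id_apply, zpow_add_one, mul_comm]
      have h1 := ih (x ^ (k + 1)) m (pow_mem hx _) (hpow k x _ hm)
      have h2 := h (k + 1) x (m + 1) hx hm'
      rw [shiftMul, MonoidHom.mul_apply, descPochhammer_eval_add_one, ← hz, hfac, h1] at h2
      rw [hfac]
      exact mul_left_cancel h2

/-- The homeomorphism `T = A_{H(𝕋)}`, restricted to `𝓗`. -/
noncomputable def calT : calH ≃ₜ calH :=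
  shiftMulHomeo.subtype mem_calH_iff_shiftMul_mem

end QDS

namespace QDS

open Filter Topology

/-! Regard `(φ_k)` as the formal power series `∑ φ_k t^k` over the endomorphism ring of the discrete
circle group. If `φ_1` acts on a torsion point `x` as the `m`-th power, membership in `calH` says
that `φ_k` acts on `x^{k!}` as the exponent `binom(m,k)`: on torsion, `φ` looks like `(1+t)^m`. By
Vandermonde's identity `calH` is then a group under series multiplication. It is compact, right
multiplications are continuous, and `T` is left multiplication by `τ = 1+t`.

The group is filtered by the order of `φ - 1`. Two facts control closed subgroups. By duality, a
closed subgroup of `H(𝕋)` is cut out by the points at which it is trivial. The commutator of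
elements with leading coefficients `α`, `β` in degrees `r`, `q` has the ring commutator of `α` and
`β` in degree `r+q`; if `α` commutes, at one point of infinite order, with every torsion-killing
`β`, then `α` is a power map. So an element whose leading coefficient is not a power map, given
enough commutators, produces all torsion-killing leading coefficients in higher degrees; in degrees
at least 2 no others occur. Successive approximation then gives two results: the powers of `τ` are
dense (`dense_zpowers_tau`), and the evaluations `φ ↦ φ_k(x)` invariant under a closed normal
subgroup separate its cosets (`exists_invariant_eval_ne`).

If `X` is a factor, density makes `calH` act on `X`, with image `E(X,s)` and closed normal kernel
`N`. The evaluations are quasi-eigenfunctions of `T`; the `N`-invariant ones descend to `E(X,s)` and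
separate its points, so Stone–Weierstrass applies. Conversely, along an orbit a quasi-eigenfunction
is a product of terms `(τ^n)_j(c_j)`, so a point-transitive system with quasi-discrete spectrum is a
factor of `calH`. This applies to `E(X,s)`, of which a minimal `X` is a factor. -/

/-! ### Homomorphisms into the circle and torsion. -/

theorem exists_circle_pow_eq (x : Circle) {n : ℕ} (hn : n ≠ 0) : ∃ y : Circle, y ^ n = x := by
  obtain ⟨θ, rfl⟩ : ∃ θ : ℝ, Circle.exp θ = x := ⟨_, Circle.exp_arg x⟩
  refine ⟨Circle.exp (θ / n), ?_⟩
  rw [← Circle.exp_nsmul]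
  congr 1
  rw [nsmul_eq_mul]
  field_simp

noncomputable instance divisibleCircle : DivisibleBy (Additive Circle) ℤ :=
  have : DivisibleBy (Additive Circle) ℕ :=
    divisibleByOfSMulRightSurj _ _ fun {n} hn x => by
      obtain ⟨y, hy⟩ := exists_circle_pow_eq x.toMul hn
      exact ⟨Additive.ofMul y, hy⟩
  AddGroup.divisibleByIntOfDivisibleByNat _

/-- The circle is divisible, hence injective by Baer's criterion, so a homomorphism on the infinite
cyclic group generated by `a` extends to `A`. -/
theorem exists_monoidHom_apply_eq {A : Type*} [CommGroup A] {a : A} (ha : ¬ IsOfFinOrder a)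
    (y : Circle) : ∃ β : A →* Circle, β a = y := by
  have hinj : Function.Injective (zmultiplesHom (Additive A) (Additive.ofMul a)) := by
    intro m n h
    have h' : a ^ m = a ^ n := h
    exact injective_zpow_iff_not_isOfFinOrder.2 ha h'
  obtain ⟨h, hh⟩ := (Module.Baer.of_divisible (Additive Circle)).extension_property_addMonoidHom
    (zmultiplesHom (Additive A) (Additive.ofMul a)) hinj
    (zmultiplesHom (Additive Circle) (Additive.ofMul y))
  refine ⟨⟨⟨fun x => (h (Additive.ofMul x)).toMul, by simp⟩, fun x y => by simp⟩, ?_⟩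
  have := DFunLike.congr_fun hh (1 : ℤ)
  have h2 : h (Additive.ofMul a) = Additive.ofMul y := by simpa using this
  exact h2

/-- A homomorphism that is trivial on elements of finite order. -/
def KillsTorsion {A : Type*} [CommGroup A] (β : A →* Circle) : Prop :=
  ∀ x, IsOfFinOrder x → β x = 1

theorem exists_killsTorsion_apply_eq {A : Type*} [CommGroup A] {a : A} (ha : ¬ IsOfFinOrder a)
    (y : Circle) : ∃ β : A →* Circle, KillsTorsion β ∧ β a = y := by
  have ha' : ¬ IsOfFinOrder (QuotientGroup.mk' (CommGroup.torsion A) a) := by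
    intro h
    obtain ⟨n, hn, h⟩ := isOfFinOrder_iff_pow_eq_one.1 h
    rw [← map_pow] at h
    have h1 : a ^ n ∈ CommGroup.torsion A := (QuotientGroup.eq_one_iff _).1 h
    exact ha ((isOfFinOrder_pow.1 h1).resolve_right hn.ne')
  obtain ⟨β, hβ⟩ := exists_monoidHom_apply_eq ha' y
  refine ⟨β.comp (QuotientGroup.mk' _), fun x hx => ?_, hβ⟩
  have : QuotientGroup.mk' (CommGroup.torsion A) x = 1 := (QuotientGroup.eq_one_iff _).2 hx
  rw [MonoidHom.comp_apply, this, map_one]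

theorem exists_not_isOfFinOrder_circle : ∃ w : Circle, ¬ IsOfFinOrder w := by
  refine ⟨Circle.exp 1, fun h => ?_⟩
  obtain ⟨n, hn, h⟩ := isOfFinOrder_iff_pow_eq_one.1 h
  rw [← Circle.exp_nsmul, Circle.exp_eq_one] at h
  obtain ⟨m, hm⟩ := h
  have hm' : (n : ℝ) = m * (2 * Real.pi) := by simpa using hm
  have hm0 : (m : ℝ) ≠ 0 := by
    rintro h0
    rw [h0, zero_mul] at hm'
    exact hn.ne' (by exact_mod_cast hm')
  refine irrational_pi ⟨(n : ℚ) / (2 * m), ?_⟩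
  push_cast
  rw [hm']
  field_simp

theorem exists_circle_orderOf_eq (n : ℕ) [NeZero n] : ∃ x : Circle, IsPrimitiveRoot x n :=
  HasEnoughRootsOfUnity.exists_primitiveRoot Circle n

/-- An endomorphism of the circle commuting, at a single point of infinite order, with all
endomorphisms that kill torsion is an integer power map. -/
theorem exists_eq_zpow_of_commute (α : Circle →* Circle) {w : Circle} (hw : ¬ IsOfFinOrder w)
    (h : ∀ β : Circle →* Circle, KillsTorsion β → α (β w) = β (α w)) :
    ∃ c : ℤ, ∀ x, α x = x ^ c := by
  -- If `α w` had infinite order modulo `⟨w⟩`, some torsion-killing `β` would kill `w` but not `α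
  -- w`, against `α (β w) = β (α w)`.
  obtain ⟨q, hq, p, hp⟩ : ∃ q : ℕ, 0 < q ∧ ∃ p : ℤ, α w ^ q = w ^ p := by
    by_contra hno
    have hz : ¬ IsOfFinOrder (QuotientGroup.mk' (Subgroup.zpowers w) (α w)) := by
      intro hf
      obtain ⟨q, hq, h1⟩ := isOfFinOrder_iff_pow_eq_one.1 hf
      rw [← map_pow] at h1
      obtain ⟨p, hp⟩ := Subgroup.mem_zpowers_iff.1 ((QuotientGroup.eq_one_iff _).1 h1)
      exact hno ⟨q, hq, p, hp.symm⟩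
    obtain ⟨y, hy⟩ := exists_not_isOfFinOrder_circle
    obtain ⟨β, hβ, hβy⟩ := exists_killsTorsion_apply_eq hz y
    have h1 := h (β.comp (QuotientGroup.mk' _)) fun x hx => hβ _ (MonoidHom.isOfFinOrder _ hx)
    have h2 : QuotientGroup.mk' (Subgroup.zpowers w) w = 1 :=
      (QuotientGroup.eq_one_iff _).2 (Subgroup.mem_zpowers w)
    rw [MonoidHom.comp_apply, MonoidHom.comp_apply, h2, map_one, map_one, hβy] at h1
    exact hy (h1 ▸ IsOfFinOrder.one)
  obtain ⟨v, hv⟩ := exists_circle_pow_eq w hq.ne'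
  have hv' : ¬ IsOfFinOrder v := fun hf => hw (hv ▸ hf.pow)
  -- The points `α w` and `v ^ p` differ by a `q`-torsion point, which `β` does not see; and `β v =
  -- y` is arbitrary.
  have key : ∀ y : Circle, α (y ^ q) = y ^ p := by
    intro y
    obtain ⟨β, hβ, hβv⟩ := exists_killsTorsion_apply_eq hv' y
    have h1 := h β hβ
    have h2 : β (α w * (v ^ p)⁻¹) = 1 := by
      refine hβ _ (isOfFinOrder_iff_pow_eq_one.2 ⟨q, hq, ?_⟩)
      rw [mul_pow, hp, inv_pow, ← hv, ← zpow_natCast, ← zpow_natCast, ← zpow_mul, ← zpow_mul,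
        mul_comm p, mul_inv_cancel]
    rw [map_mul, map_inv, mul_inv_eq_one, map_zpow, hβv] at h2
    rw [← hv, map_pow, hβv, hv, h2] at h1
    exact h1
  have : NeZero q := ⟨hq.ne'⟩
  -- A primitive `q`-th root of unity forces `q ∣ p`.
  obtain ⟨ζ, hζ⟩ := exists_circle_orderOf_eq q
  have h1 := key ζ
  rw [hζ.pow_eq_one, map_one] at h1
  obtain ⟨c, rfl⟩ := (hζ.zpow_eq_one_iff_dvd p).1 h1.symm
  refine ⟨c, fun x => ?_⟩
  obtain ⟨y, rfl⟩ := exists_circle_pow_eq x hq.ne'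
  rw [key, zpow_mul, zpow_natCast]

/-! ### The compact group `H(𝕋)` and duality for its closed subgroups. -/

theorem continuous_eval_hom (x : Circle) : Continuous fun φ : Circle →* Circle => φ x :=
  (continuous_apply x).comp continuous_induced_dom

theorem isClosedEmbedding_coe_hom :
    Topology.IsClosedEmbedding fun φ : Circle →* Circle => (φ : Circle → Circle) :=
  ⟨⟨⟨rfl⟩, DFunLike.coe_injective⟩, MonoidHom.isClosed_range_coe Circle Circle⟩

instance : T2Space (Circle →* Circle) := isClosedEmbedding_coe_hom.isEmbedding.t2Space

instance : CompactSpace (Circle →* Circle) := isClosedEmbedding_coe_hom.compactSpace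


/-- Stone-Weierstrass for a separating group of circle-valued functions. -/
theorem dense_span_of_separatesPoints {K : Type*} [TopologicalSpace K] [CompactSpace K]
    (S : Subgroup C(K, Circle)) (hS : ∀ a b : K, (∀ g ∈ S, g a = g b) → a = b) :
    Dense (Submodule.span ℂ {F : C(K, ℂ) | ∃ g ∈ S, ∀ x, F x = (g x : ℂ)} : Set C(K, ℂ)) := by
  set U : Set C(K, ℂ) := {F : C(K, ℂ) | ∃ g ∈ S, ∀ x, F x = (g x : ℂ)} with hU
  let M : Submonoid C(K, ℂ) :=
    { carrier := U
      one_mem' := ⟨1, S.one_mem, fun x => by simp⟩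
      mul_mem' := by
        rintro F F' ⟨g, hg, h⟩ ⟨g', hg', h'⟩
        exact ⟨g * g', S.mul_mem hg hg', fun x => by simp [h, h']⟩ }
  have hstar : ∀ F ∈ U, star F ∈ U := by
    rintro F ⟨g, hg, h⟩
    exact ⟨g⁻¹, S.inv_mem hg, fun x => by
      rw [ContinuousMap.star_apply, h, ContinuousMap.inv_apply, Circle.coe_inv_eq_conj]; rfl⟩
  have hspan : (Algebra.adjoin ℂ U).toSubmodule = Submodule.span ℂ U := by
    rw [Algebra.adjoin_eq_span]
    congr 1
    exact congrArg SetLike.coe (Submonoid.closure_eq M)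
  have hmem : ∀ F, F ∈ Algebra.adjoin ℂ U ↔ F ∈ Submodule.span ℂ U := by
    intro F
    rw [← hspan]
    rfl
  let A : StarSubalgebra ℂ C(K, ℂ) :=
    { Algebra.adjoin ℂ U with
      star_mem' := by
        intro F hF
        have hF' : F ∈ Submodule.span ℂ U := (hmem F).1 hF
        refine (hmem _).2 ?_
        clear hF
        induction hF' using Submodule.span_induction with
        | mem F hF => exact Submodule.subset_span (hstar F hF)
        | zero => rw [star_zero]; exact Submodule.zero_mem _
        | add F G hF hG h1 h2 =>
          rw [star_add]
          exact Submodule.add_mem _ h1 h2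
        | smul c F hF h1 =>
          rw [star_smul]
          exact Submodule.smul_mem _ _ h1 }
  have hsep : A.SeparatesPoints := by
    intro a b hab
    by_contra hno
    refine hab (hS a b fun g hg => ?_)
    by_contra hne
    refine hno ⟨_, ⟨⟨fun x => (g x : ℂ), by fun_prop⟩,
      Algebra.subset_adjoin ⟨g, hg, fun x => rfl⟩, rfl⟩, ?_⟩
    exact fun h => hne (Circle.coe_injective h)
  have htop := ContinuousMap.starSubalgebra_topologicalClosure_eq_top_of_separatesPoints A hsep
  have hA : (A : Set C(K, ℂ)) = (Submodule.span ℂ U : Set C(K, ℂ)) := Set.ext hmem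
  rw [← hA, dense_iff_closure_eq, ← StarSubalgebra.topologicalClosure_coe, htop]
  rfl

/-- Evaluation at a point, as a continuous function on the group of endomorphisms. -/
noncomputable def evalHom (x : Circle) : C(Circle →* Circle, Circle) :=
  ⟨fun φ => φ x, continuous_eval_hom x⟩

/-- The continuous functional `f ↦ ∫ f (φ c) dc`, where `c` runs through a closed subgroup. -/
theorem exists_translate_mean (C : Subgroup (Circle →* Circle)) [CompactSpace C] :
    ∃ Λ : (Circle →* Circle) → C(Circle →* Circle, ℂ) →L[ℂ] ℂ,
      (∀ φ f b g, (∀ c ∈ C, f (φ * c) = b * g c) → Λ φ f = b * Λ 1 g) ∧ Λ 1 1 = 1 ∧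
      ∀ c ∈ C, ∀ f, Λ c f = Λ 1 f := by
  let _ : MeasurableSpace C := borel C
  have : BorelSpace C := ⟨rfl⟩
  let μ : MeasureTheory.Measure C := MeasureTheory.Measure.haarMeasure ⊤
  have hμ : μ Set.univ = 1 := MeasureTheory.Measure.haarMeasure_self
  have : MeasureTheory.IsProbabilityMeasure μ := ⟨hμ⟩
  have hcont : ∀ (φ : Circle →* Circle) (f : C(Circle →* Circle, ℂ)),
      Continuous fun c : C => f (φ * c) := fun φ f =>
    f.continuous.comp (continuous_const.mul continuous_subtype_val)
  have hint : ∀ (φ : Circle →* Circle) (f : C(Circle →* Circle, ℂ)),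
      MeasureTheory.Integrable (fun c : C => f (φ * c)) μ := fun φ f =>
    (hcont φ f).integrable_of_hasCompactSupport (HasCompactSupport.of_compactSpace _)
  let Λ : (Circle →* Circle) → C(Circle →* Circle, ℂ) →L[ℂ] ℂ := fun φ =>
    LinearMap.mkContinuous
      { toFun := fun f => ∫ c : C, f (φ * c) ∂μ
        map_add' := fun f g => MeasureTheory.integral_add (hint φ f) (hint φ g)
        map_smul' := fun a f => MeasureTheory.integral_const_mul a _ } 1 (fun f => by
      have := MeasureTheory.norm_integral_le_of_norm_le_const (μ := μ)
        (f := fun c : C => f (φ * c)) (C := ‖f‖)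
        (Filter.Eventually.of_forall fun c => f.norm_coe_le_norm _)
      simpa using this)
  refine ⟨Λ, fun φ f b g h => ?_, ?_, fun c hc f => ?_⟩
  · change ∫ c : C, f (φ * c) ∂μ = b * ∫ c : C, g (1 * c) ∂μ
    rw [← MeasureTheory.integral_const_mul]
    congr 1
    funext c
    rw [h c c.2, one_mul]
  · change ∫ c : C, (1 : ℂ) ∂μ = 1
    simp
  · change ∫ d : C, f (c * d) ∂μ = ∫ d : C, f (1 * d) ∂μ
    simpa using MeasureTheory.integral_mul_left_eq_self (μ := μ) (fun d : C => f d) ⟨c, hc⟩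

/-- A closed subgroup of the group of endomorphisms of the circle is determined by the points at
which all its elements are trivial. -/
theorem mem_of_forall_apply_eq_one {C : Subgroup (Circle →* Circle)}
    (hC : IsClosed (C : Set (Circle →* Circle))) {φ : Circle →* Circle}
    (h : ∀ w, (∀ c ∈ C, c w = 1) → φ w = 1) : φ ∈ C := by
  by_contra hφ
  have : CompactSpace C := isCompact_iff_compactSpace.1 hC.isCompact
  obtain ⟨Λ, hmul, hone, hinv⟩ := exists_translate_mean C
  let S : Subgroup C(Circle →* Circle, Circle) :=
    { carrier := Set.range evalHom
      one_mem' := ⟨1, by ext ψ; simp [evalHom]⟩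
      mul_mem' := by
        rintro _ _ ⟨x, rfl⟩ ⟨y, rfl⟩
        exact ⟨x * y, by ext ψ; simp [evalHom]⟩
      inv_mem' := by
        rintro _ ⟨x, rfl⟩
        exact ⟨x⁻¹, by ext ψ; simp [evalHom]⟩ }
  have hdense := dense_span_of_separatesPoints S fun a b hab => by
    ext x
    exact congrArg _ (hab _ ⟨x, rfl⟩)
  -- The means over `φC` and `C` agree on each character: one trivial on `C` is trivial at `φ`, and
  -- any other has mean zero over both cosets.
  have heq : Λ φ = Λ 1 := by
    refine ContinuousLinearMap.ext_on hdense ?_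
    rintro F ⟨_, ⟨x, rfl⟩, hF⟩
    have hF' : ∀ ψ : Circle →* Circle, F ψ = (ψ x : ℂ) := hF
    have hΛ : ∀ ψ : Circle →* Circle, Λ ψ F = (ψ x : ℂ) * Λ 1 F := fun ψ =>
      hmul ψ F _ F fun c _ => by simp [hF']
    by_cases hx : ∀ c ∈ C, c x = 1
    · rw [hΛ φ, h x hx, Circle.coe_one, one_mul]
    · push Not at hx
      obtain ⟨c, hc, hcx⟩ := hx
      have h0 : Λ 1 F = 0 := by
        have h1 := (hinv c hc F).symm.trans (hΛ c)
        by_contra hne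
        exact hcx (Circle.coe_injective (mul_right_cancel₀ hne (by simpa using h1.symm)))
      rw [hΛ φ, h0, mul_zero]
  -- A Urysohn function, 0 on `C` and 1 on the disjoint coset `φC`, distinguishes the two means.
  obtain ⟨f, hf0, hf1, -⟩ := exists_continuous_zero_one_of_isClosed (s := (C : Set _))
    (t := (fun c => φ⁻¹ * c) ⁻¹' (C : Set _)) hC (hC.preimage (continuous_const.mul continuous_id))
    (Set.disjoint_left.2 fun c hc hc' => hφ (by
      have := C.mul_mem hc (C.inv_mem hc')
      simpa using this))
  let F : C(Circle →* Circle, ℂ) := ⟨fun ψ => (f ψ : ℂ), by fun_prop⟩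
  have h1 : Λ φ F = 1 := by
    rw [hmul φ F 1 1 fun c hc => ?_, hone, one_mul]
    have : f (φ * c) = 1 := hf1 (by simpa using hc)
    simp [F, this]
  have h0 : Λ 1 F = 0 := by
    rw [hmul 1 F 0 1 fun c hc => ?_, zero_mul]
    have : f c = 0 := hf0 hc
    simp [F, this]
  rw [heq, h0] at h1
  exact zero_ne_one h1

/-! ### `calH` as a compact group of formal power series. -/

/-- The product of sequences of endomorphisms of the circle, regarded as formal power series. -/
noncomputable def convMul (ψ φ : ℕ → (Circle →* Circle)) (k : ℕ) : Circle →* Circle :=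
  ∏ p ∈ Finset.HasAntidiagonal.antidiagonal k, (ψ p.1).comp (φ p.2)

theorem convMul_apply (ψ φ : ℕ → (Circle →* Circle)) (k : ℕ) (x : Circle) :
    convMul ψ φ k x = ∏ p ∈ Finset.HasAntidiagonal.antidiagonal k, ψ p.1 (φ p.2 x) := by
  simp [convMul, MonoidHom.finsetProd_apply]

/-- The unit of `convMul`. -/
noncomputable def convOne : ℕ → (Circle →* Circle) := fun k => if k = 0 then MonoidHom.id Circle else 1

/-- Endomorphisms of the circle, as elements of the endomorphism ring. -/
noncomputable def endEquiv : (Circle →* Circle) ≃ AddMonoid.End (Additive Circle) :=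
  MonoidHom.toAdditive

theorem endEquiv_id : endEquiv (MonoidHom.id Circle) = 1 := rfl

theorem endEquiv_one : endEquiv 1 = 0 := rfl

theorem endEquiv_convMul (ψ φ : ℕ → (Circle →* Circle)) (k : ℕ) :
    endEquiv (convMul ψ φ k) =
      ∑ p ∈ Finset.HasAntidiagonal.antidiagonal k, endEquiv (ψ p.1) * endEquiv (φ p.2) := by
  have h : ∀ s : Finset (ℕ × ℕ), endEquiv (∏ p ∈ s, (ψ p.1).comp (φ p.2)) =
      ∑ p ∈ s, endEquiv (ψ p.1) * endEquiv (φ p.2) := by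
    intro s
    induction s using Finset.induction_on with
    | empty => rfl
    | insert p s hp ih =>
      rw [Finset.prod_insert hp, Finset.sum_insert hp, ← ih]
      rfl
  exact h _

/-- The formal power series over `End 𝕋` with the given coefficients. -/
noncomputable def toSeries (φ : ℕ → (Circle →* Circle)) :
    PowerSeries (AddMonoid.End (Additive Circle)) :=
  PowerSeries.mk fun k => endEquiv (φ k)

theorem coeff_toSeries (φ : ℕ → (Circle →* Circle)) (k : ℕ) :
    PowerSeries.coeff k (toSeries φ) = endEquiv (φ k) :=
  PowerSeries.coeff_mk _ _

theorem toSeries_injective : Function.Injective toSeries := fun ψ φ h => funext fun k =>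
  endEquiv.injective (by rw [← coeff_toSeries, h, coeff_toSeries])

theorem toSeries_surjective : Function.Surjective toSeries := fun f =>
  ⟨fun k => endEquiv.symm (PowerSeries.coeff k f), by
    ext1 k
    rw [coeff_toSeries, Equiv.apply_symm_apply]⟩

theorem toSeries_convMul (ψ φ : ℕ → (Circle →* Circle)) :
    toSeries (convMul ψ φ) = toSeries ψ * toSeries φ := by
  ext1 k
  rw [PowerSeries.coeff_mul, coeff_toSeries, endEquiv_convMul]
  simp only [coeff_toSeries]

theorem toSeries_convOne : toSeries convOne = 1 := by
  ext1 k
  rw [PowerSeries.coeff_one, coeff_toSeries, convOne]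
  split_ifs
  · exact endEquiv_id
  · exact endEquiv_one

theorem convMul_assoc (a b c : ℕ → (Circle →* Circle)) :
    convMul (convMul a b) c = convMul a (convMul b c) :=
  toSeries_injective (by simp only [toSeries_convMul, mul_assoc])

theorem convMul_one (a : ℕ → (Circle →* Circle)) : convMul a convOne = a :=
  toSeries_injective (by simp only [toSeries_convMul, toSeries_convOne, mul_one])

theorem exists_convMul_eq_one (a : ℕ → (Circle →* Circle)) (ha : a 0 = MonoidHom.id Circle) :
    ∃ b, b 0 = MonoidHom.id Circle ∧ convMul a b = convOne := by
  have hc : PowerSeries.constantCoeff (toSeries a)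
      = ((1 : (AddMonoid.End (Additive Circle))ˣ) : AddMonoid.End (Additive Circle)) := by
    rw [← PowerSeries.coeff_zero_eq_constantCoeff_apply, coeff_toSeries, ha, endEquiv_id,
      Units.val_one]
  obtain ⟨b, hb⟩ := toSeries_surjective (PowerSeries.invOfUnit (toSeries a) 1)
  refine ⟨b, endEquiv.injective ?_, toSeries_injective ?_⟩
  · rw [← coeff_toSeries, hb, PowerSeries.coeff_zero_eq_constantCoeff_apply,
      PowerSeries.constantCoeff_invOfUnit, endEquiv_id, inv_one, Units.val_one]
  · rw [toSeries_convMul, hb, toSeries_convOne]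
    exact PowerSeries.mul_invOfUnit _ _ hc

theorem descPochhammer_eval_eq_factorial_mul_choose (k : ℕ) (m : ℤ) :
    (descPochhammer ℤ k).eval m = k.factorial * Ring.choose m k := by
  have h := Ring.descPochhammer_eq_factorial_smul_choose m k
  rw [nsmul_eq_mul] at h
  rw [← h, Polynomial.eval_eq_smeval]

theorem mem_calH_iff_choose (φ : ℕ → (Circle →* Circle)) :
    φ ∈ calH ↔ φ 0 = MonoidHom.id Circle ∧
      ∀ (k : ℕ) (x : Circle) (m : ℤ), IsOfFinOrder x → φ 1 x = x ^ m →
        φ k (x ^ k.factorial) = (x ^ k.factorial) ^ Ring.choose m k := by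
  rw [mem_calH_iff]
  simp only [descPochhammer_eval_eq_factorial_mul_choose, zpow_mul, zpow_natCast]
  rfl

/-- Since `j! ∣ k!`, the single point `x^{k!}` serves all degrees `j ≤ k`, which is what a Cauchy
product of degree `k` needs. -/
theorem apply_pow_factorial {φ : ℕ → (Circle →* Circle)} (hφ : φ ∈ calH) {j k : ℕ} (hjk : j ≤ k)
    {x : Circle} {m : ℤ} (hx : IsOfFinOrder x) (hm : φ 1 x = x ^ m) :
    φ j (x ^ k.factorial) = (x ^ k.factorial) ^ Ring.choose m j := by
  obtain ⟨d, hd⟩ := Nat.factorial_dvd_factorial hjk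
  rw [hd, pow_mul, map_pow, ((mem_calH_iff_choose φ).1 hφ).2 j x m hx hm, ← zpow_natCast,
    ← zpow_mul, ← zpow_natCast _ d, ← zpow_mul, mul_comm]

theorem prod_zpow_eq_zpow_sum {ι : Type*} (s : Finset ι) (f : ι → ℤ) (x : Circle) :
    ∏ i ∈ s, x ^ f i = x ^ ∑ i ∈ s, f i := by
  classical
  induction s using Finset.induction_on with
  | empty => simp
  | insert i s hi ih => rw [Finset.prod_insert hi, Finset.sum_insert hi, ih, zpow_add]

theorem convMul_one_apply {ψ φ : ℕ → (Circle →* Circle)} (hψ : ψ 0 = MonoidHom.id Circle)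
    (hφ : φ 0 = MonoidHom.id Circle) (x : Circle) :
    convMul ψ φ 1 x = φ 1 x * ψ 1 x := by
  rw [convMul_apply, Finset.Nat.antidiagonal_succ]
  simp [hψ, hφ]

/-- On torsion this is `(1+t)^a (1+t)^b = (1+t)^{a+b}`, that is, Vandermonde's identity. -/
theorem convMul_mem_calH {ψ φ : ℕ → (Circle →* Circle)} (hψ : ψ ∈ calH) (hφ : φ ∈ calH) :
    convMul ψ φ ∈ calH := by
  refine (mem_calH_iff_choose _).2 ⟨?_, fun k x m hx hm => ?_⟩
  · ext x
    simp [convMul_apply, hψ.1, hφ.1]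
  · obtain ⟨a, ha⟩ := exists_apply_eq_zpow (ψ 1) hx
    have hb : φ 1 x = x ^ (m - a) := by
      rw [convMul_one_apply hψ.1 hφ.1, ha] at hm
      rw [zpow_sub, ← hm, mul_inv_cancel_right]
    have hm' : m = a + (m - a) := by ring
    rw [convMul_apply, hm', Ring.add_choose_eq k (Commute.all _ _), ← prod_zpow_eq_zpow_sum]
    refine Finset.prod_congr rfl fun p hp => ?_
    rw [Finset.HasAntidiagonal.mem_antidiagonal] at hp
    rw [apply_pow_factorial hφ (by omega) hx hb, map_zpow,
      apply_pow_factorial hψ (by omega) hx ha, ← zpow_mul]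

/-- Vandermonde for `-m + m = 0` gives the binomials the same recursion as the coefficients of the
inverse. -/
theorem mem_calH_of_convMul_eq_one {a b : ℕ → (Circle →* Circle)} (ha : a ∈ calH)
    (hb : b 0 = MonoidHom.id Circle) (hab : convMul a b = convOne) : b ∈ calH := by
  refine (mem_calH_iff_choose _).2 ⟨hb, fun K x m hx hm => ?_⟩
  have ha1 : a 1 x = x ^ (-m) := by
    have h := convMul_one_apply ha.1 hb x
    rw [hab, hm] at h
    rw [zpow_neg]
    exact eq_inv_of_mul_eq_one_right h.symm
  suffices h : ∀ k, k ≤ K → b k (x ^ K.factorial) = (x ^ K.factorial) ^ Ring.choose m k from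
    h K le_rfl
  intro k
  induction k using Nat.strong_induction_on with
  | _ k ih =>
    intro hk
    cases k with
    | zero => simp [hb]
    | succ k =>
      have h1 : convMul a b (k + 1) (x ^ K.factorial) = 1 := by
        rw [hab]
        rfl
      have h2 : Ring.choose (-m + m) (k + 1) = 0 := by
        rw [neg_add_cancel, Ring.choose_zero_succ]
      rw [Ring.add_choose_eq (k + 1) (Commute.all _ _),
        Finset.Nat.sum_antidiagonal_succ] at h2
      rw [convMul_apply, Finset.Nat.prod_antidiagonal_succ] at h1
      have h3 : ∏ p ∈ Finset.HasAntidiagonal.antidiagonal k,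
          a (p.1 + 1) (b p.2 (x ^ K.factorial)) = (x ^ K.factorial) ^
            ∑ p ∈ Finset.HasAntidiagonal.antidiagonal k,
              Ring.choose (-m) (p.1 + 1) * Ring.choose m p.2 := by
        rw [← prod_zpow_eq_zpow_sum]
        refine Finset.prod_congr rfl fun p hp => ?_
        rw [Finset.HasAntidiagonal.mem_antidiagonal] at hp
        rw [ih p.2 (by omega) (by omega), map_zpow, apply_pow_factorial ha (by omega) hx ha1,
          ← zpow_mul]
      rw [Ring.choose_zero_right, one_mul] at h2
      rw [h3, ha.1, MonoidHom.id_apply] at h1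
      rw [eq_inv_of_mul_eq_one_left h1, ← zpow_neg]
      congr 1
      simp only at h2
      omega

theorem convOne_mem_calH : convOne ∈ calH := by
  refine (mem_calH_iff_choose _).2 ⟨rfl, fun k x m hx hm => ?_⟩
  have hm1 : x ^ m = 1 := hm.symm
  cases k with
  | zero => simp [convOne]
  | succ k =>
    have h2 : (1 : Circle) = x ^ (descPochhammer ℤ (k + 1)).eval m := by
      -- The exponent `m` need not be 0, only `x ^ m = 1`; the falling factorial of `m` has the
      -- factor `m`.
      obtain ⟨d, hd⟩ : m ∣ (descPochhammer ℤ (k + 1)).eval m := by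
        rw [descPochhammer_succ_left]
        simp
      rw [hd, zpow_mul, hm1, one_zpow]
    rw [descPochhammer_eval_eq_factorial_mul_choose, zpow_mul, zpow_natCast] at h2
    exact h2

noncomputable instance : Group calH :=
  let _ : Mul calH := ⟨fun a b => ⟨convMul a.1 b.1, convMul_mem_calH a.2 b.2⟩⟩
  let _ : One calH := ⟨⟨convOne, convOne_mem_calH⟩⟩
  let _ : Inv calH := ⟨fun a => ⟨(exists_convMul_eq_one a.1 a.2.1).choose,
    mem_calH_of_convMul_eq_one a.2 (exists_convMul_eq_one a.1 a.2.1).choose_spec.1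
      (exists_convMul_eq_one a.1 a.2.1).choose_spec.2⟩⟩
  Group.ofRightAxioms (fun a b c => Subtype.ext (convMul_assoc a.1 b.1 c.1))
    (fun a => Subtype.ext (convMul_one a.1))
    (fun a => Subtype.ext (exists_convMul_eq_one a.1 a.2.1).choose_spec.2)

theorem calH_mul_apply (ψ φ : calH) (k : ℕ) (x : Circle) :
    (ψ * φ).1 k x = ∏ p ∈ Finset.HasAntidiagonal.antidiagonal k, ψ.1 p.1 (φ.1 p.2 x) :=
  convMul_apply ψ.1 φ.1 k x

theorem calH_one_apply_succ (k : ℕ) : (1 : calH).1 (k + 1) = 1 := rfl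

theorem calH_one_apply {k : ℕ} (hk : k ≠ 0) : (1 : calH).1 k = 1 := if_neg hk

theorem calH_apply_zero (φ : calH) : φ.1 0 = MonoidHom.id Circle := φ.2.1

theorem isClosed_calH : IsClosed calH := by
  have h : calH = ⋂ (x : Circle), {φ : ℕ → (Circle →* Circle) | φ 0 x = x} ∩
      ⋂ (k : ℕ) (m : ℤ) (_ : IsOfFinOrder x),
        {φ | φ 1 x = x ^ m → φ k (x ^ k.factorial) = (x ^ k.factorial) ^ Ring.choose m k} := by
    ext φ
    simp only [mem_calH_iff_choose, Set.mem_iInter, Set.mem_inter_iff, Set.mem_ofPred_eq,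
      DFunLike.ext_iff, MonoidHom.id_apply]
    constructor
    · rintro ⟨h0, h⟩ x
      exact ⟨h0 x, fun k m hx => h k x m hx⟩
    · intro h
      exact ⟨fun x => (h x).1, fun k x m hx => (h x).2 k m hx⟩
  have hev : ∀ (k : ℕ) (x : Circle), Continuous fun φ : ℕ → (Circle →* Circle) => φ k x :=
    fun k x => (continuous_eval_hom x).comp (continuous_apply k)
  rw [h]
  refine isClosed_iInter fun x => (isClosed_eq (hev 0 x) continuous_const).inter
    (isClosed_iInter fun k => isClosed_iInter fun m => isClosed_iInter fun hx => ?_)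
  -- As `φ_1(x)` lies in the finite group `⟨x⟩`, the condition `φ_1(x) ≠ x^m` is closed, so the
  -- implication is a union of two closed conditions.
  have hfin : ((Subgroup.zpowers x : Set Circle) \ {x ^ m}).Finite := (finite_zpowers.2 hx).sdiff
  convert (hfin.isClosed.preimage (hev 1 x)).union
    (isClosed_eq (hev k (x ^ k.factorial)) continuous_const) using 1
  ext φ
  have hφ : φ 1 x ∈ Subgroup.zpowers x := by
    obtain ⟨i, hi⟩ := exists_apply_eq_zpow (φ 1) hx
    exact Subgroup.mem_zpowers_iff.2 ⟨i, hi.symm⟩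
  simp only [Set.mem_ofPred_eq, Set.mem_union, Set.mem_preimage, Set.mem_sdiff, SetLike.mem_coe,
    hφ, true_and, Set.mem_singleton_iff]
  exact imp_iff_not_or

instance : CompactSpace calH := isCompact_iff_compactSpace.1 isClosed_calH.isCompact

theorem continuous_eval_calH (k : ℕ) (x : Circle) : Continuous fun φ : calH => φ.1 k x :=
  (continuous_eval_hom x).comp ((continuous_apply k).comp continuous_subtype_val)

theorem continuous_coeff_calH (k : ℕ) : Continuous fun φ : calH => φ.1 k :=
  (continuous_apply k).comp continuous_subtype_val

theorem continuous_calH_iff {Z : Type*} [TopologicalSpace Z] {f : Z → calH} :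
    Continuous f ↔ ∀ k x, Continuous fun z => (f z).1 k x := by
  simp only [continuous_induced_rng, continuous_pi_iff, Function.comp_def]

/-- The left factor is only evaluated at fixed points. Varying the right factor would feed moving
points into possibly discontinuous endomorphisms. -/
theorem continuous_mul_right_calH (φ : calH) : Continuous fun ψ : calH => ψ * φ := by
  refine continuous_calH_iff.2 fun k x => ?_
  simp only [calH_mul_apply]
  exact continuous_finsetProd _ fun p _ => continuous_eval_calH _ _


/-! ### The filtration by order, leading coefficients and commutators. -/

/-- Elements of `𝓗` whose coefficients between `0` and `r` are trivial. -/
def orderGE (r : ℕ) : Set calH := {φ | ∀ k, k ≠ 0 → k < r → φ.1 k = 1}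

theorem orderGE_one (φ : calH) : φ ∈ orderGE 1 := fun k hk hk' => absurd hk' (by omega)

theorem orderGE_succ {r : ℕ} {φ : calH} (hφ : φ ∈ orderGE r) (h : φ.1 r = 1) :
    φ ∈ orderGE (r + 1) := fun k hk hk' => by
  rcases Nat.lt_succ_iff_lt_or_eq.1 hk' with h' | rfl
  · exact hφ k hk h'
  · exact h

theorem mul_apply_of_orderGE_right (ψ : calH) {ν : calH} {r : ℕ} (hν : ν ∈ orderGE r) {k : ℕ}
    (hk : k ≠ 0) (hkr : k ≤ r) : (ψ * ν).1 k = ψ.1 k * ν.1 k := by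
  ext1 x
  obtain ⟨k, rfl⟩ := Nat.exists_eq_succ_of_ne_zero hk
  rw [calH_mul_apply, Finset.Nat.prod_antidiagonal_succ, MonoidHom.mul_apply, mul_comm]
  congr 1
  · rw [Finset.prod_eq_single (k, 0)]
    · simp [calH_apply_zero]
    · rintro ⟨i, j⟩ hp hne
      rw [Finset.HasAntidiagonal.mem_antidiagonal] at hp
      simp only at hp
      have hj : j ≠ 0 := by
        rintro rfl
        exact hne (by simp [← hp])
      simp [hν j hj (by omega)]
    · intro h
      exact absurd (Finset.HasAntidiagonal.mem_antidiagonal.2 (by simp)) h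
  · simp [calH_apply_zero]

theorem mul_apply_of_orderGE_left {ν : calH} (ψ : calH) {r : ℕ} (hν : ν ∈ orderGE r) {k : ℕ}
    (hk : k ≠ 0) (hkr : k ≤ r) : (ν * ψ).1 k = ν.1 k * ψ.1 k := by
  ext1 x
  obtain ⟨k, rfl⟩ := Nat.exists_eq_succ_of_ne_zero hk
  rw [calH_mul_apply, Finset.Nat.prod_antidiagonal_succ', MonoidHom.mul_apply]
  congr 1
  · simp [calH_apply_zero]
  · rw [Finset.prod_eq_single (0, k)]
    · simp [calH_apply_zero]
    · rintro ⟨i, j⟩ hp hne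
      rw [Finset.HasAntidiagonal.mem_antidiagonal] at hp
      simp only at hp
      have hj : i ≠ 0 := by
        rintro rfl
        exact hne (by simp [← hp])
      simp [hν i hj (by omega)]
    · intro h
      exact absurd (Finset.HasAntidiagonal.mem_antidiagonal.2 (by simp)) h

theorem mul_inv_apply_of_forall_lt {u v : calH} {n : ℕ} (h : ∀ k, k < n → u.1 k = v.1 k) :
    v * u⁻¹ ∈ orderGE n ∧ (n ≠ 0 → (v * u⁻¹).1 n = v.1 n * (u.1 n)⁻¹) := by
  have key : ∀ k, k ≠ 0 → k ≤ n → v * u⁻¹ ∈ orderGE k →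
      (v * u⁻¹).1 k = v.1 k * (u.1 k)⁻¹ := by
    intro k hk hkn hord
    rw [eq_mul_inv_iff_mul_eq, ← mul_apply_of_orderGE_left u hord hk le_rfl,
      inv_mul_cancel_right]
  have hmem : ∀ k, k ≤ n → v * u⁻¹ ∈ orderGE k := by
    intro k
    induction k with
    | zero => exact fun _ j _ hj => absurd hj (by omega)
    | succ k ih =>
      intro hk
      rcases eq_or_ne k 0 with rfl | hk0
      · exact orderGE_one _
      · refine orderGE_succ (ih (by omega)) ?_
        rw [key k hk0 (by omega) (ih (by omega)), h k (by omega), mul_inv_cancel]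
  exact ⟨hmem n le_rfl, fun hn => key n hn le_rfl (hmem n le_rfl)⟩

theorem orderGE_mul {a b : calH} {r : ℕ} (ha : a ∈ orderGE r) (hb : b ∈ orderGE r) :
    a * b ∈ orderGE r := fun k hk hkr => by
  rw [mul_apply_of_orderGE_left b ha hk hkr.le, ha k hk hkr, hb k hk hkr, mul_one]

theorem orderGE_inv {a : calH} {r : ℕ} (ha : a ∈ orderGE r) : a⁻¹ ∈ orderGE r := by
  have h := (mul_inv_apply_of_forall_lt (u := a) (v := 1) (n := r) fun k hk => ?_).1
  · rwa [one_mul] at h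
  · rcases eq_or_ne k 0 with rfl | hk0
    · rw [calH_apply_zero, calH_apply_zero]
    · rw [ha k hk0 hk, calH_one_apply hk0]

theorem inv_apply_of_orderGE {a : calH} {r : ℕ} (ha : a ∈ orderGE r) (hr : r ≠ 0) :
    a⁻¹.1 r = (a.1 r)⁻¹ := by
  have h := mul_apply_of_orderGE_left a⁻¹ ha hr le_rfl
  rw [mul_inv_cancel, calH_one_apply hr] at h
  exact eq_inv_of_mul_eq_one_right h.symm

/-- A cross term of degree `i + j` vanishes if `0 < i < r` or `0 < j < q`, so the first possible one
has degree `r + q`. -/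
theorem mul_apply_of_orderGE {a b : calH} {r q : ℕ} (ha : a ∈ orderGE r) (hb : b ∈ orderGE q)
    (hr : r ≠ 0) (hq : q ≠ 0) {k : ℕ} (hk : k ≠ 0) :
    (k < r + q → (a * b).1 k = a.1 k * b.1 k) ∧
    (k = r + q → (a * b).1 k = a.1 k * b.1 k * (a.1 r).comp (b.1 q)) := by
  obtain ⟨k, rfl⟩ := Nat.exists_eq_succ_of_ne_zero hk
  cases k with
  | zero =>
    refine ⟨fun h => ?_, fun h => by omega⟩
    exact mul_apply_of_orderGE_left b (orderGE_one a) one_ne_zero le_rfl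
  | succ k =>
    have hsplit : ∀ x, (a * b).1 (k + 2) x = a.1 (k + 2) x * b.1 (k + 2) x *
        ∏ p ∈ Finset.HasAntidiagonal.antidiagonal k, a.1 (p.1 + 1) (b.1 (p.2 + 1) x) := by
      intro x
      rw [calH_mul_apply, Finset.Nat.prod_antidiagonal_succ,
        Finset.Nat.prod_antidiagonal_succ']
      simp only [calH_apply_zero, MonoidHom.id_apply]
      rw [← mul_assoc, mul_comm (b.1 (k + 2) x)]
    constructor
    · intro h
      ext1 x
      rw [hsplit, Finset.prod_eq_one, mul_one, MonoidHom.mul_apply]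
      rintro ⟨i, j⟩ hp
      rw [Finset.HasAntidiagonal.mem_antidiagonal] at hp
      simp only at hp
      by_cases hi : i + 1 < r
      · simp [ha (i + 1) (by omega) hi]
      · simp [hb (j + 1) (by omega) (by omega)]
    · intro h
      ext1 x
      rw [hsplit, Finset.prod_eq_single (r - 1, q - 1)]
      · simp only [Nat.sub_add_cancel (Nat.one_le_iff_ne_zero.2 hr),
          Nat.sub_add_cancel (Nat.one_le_iff_ne_zero.2 hq)]
        rfl
      · rintro ⟨i, j⟩ hp hne
        rw [Finset.HasAntidiagonal.mem_antidiagonal] at hp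
        simp only at hp
        by_cases hi : i + 1 < r
        · simp [ha (i + 1) (by omega) hi]
        · by_cases hj : j + 1 < q
          · simp [hb (j + 1) (by omega) hj]
          · refine absurd ?_ hne
            ext <;> simp <;> omega
      · intro h'
        exact absurd (Finset.HasAntidiagonal.mem_antidiagonal.2 (by simp; omega)) h'

/-- Group commutators multiply orders; the leading coefficient is the ring commutator. -/
theorem commutator_orderGE {a b : calH} {r q : ℕ} (ha : a ∈ orderGE r) (hb : b ∈ orderGE q)
    (hr : r ≠ 0) (hq : q ≠ 0) :
    a * b * (b * a)⁻¹ ∈ orderGE (r + q) ∧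
      ∀ x, (a * b * (b * a)⁻¹).1 (r + q) x = a.1 r (b.1 q x) * (b.1 q (a.1 r x))⁻¹ := by
  obtain ⟨h1, h2⟩ := mul_inv_apply_of_forall_lt (u := b * a) (v := a * b) (n := r + q)
    fun k hk => by
      rcases eq_or_ne k 0 with rfl | hk0
      · rw [calH_apply_zero, calH_apply_zero]
      · rw [(mul_apply_of_orderGE ha hb hr hq hk0).1 hk,
          (mul_apply_of_orderGE hb ha hq hr hk0).1 (by omega), mul_comm]
  refine ⟨h1, fun x => ?_⟩
  rw [h2 (by omega), (mul_apply_of_orderGE ha hb hr hq (by omega)).2 rfl,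
    (mul_apply_of_orderGE hb ha hq hr (by omega)).2 (add_comm _ _), mul_comm (b.1 (r + q)),
    mul_inv, mul_mul_mul_comm, mul_inv_cancel, one_mul]
  rfl

/-- For `n ≥ 2` the coefficient `φ_1` is trivial, so on torsion `φ_n` has exponent `binom(0,n) = 0`;
every torsion point is an `n!`-th power of one. -/
theorem killsTorsion_apply_of_orderGE {φ : calH} {n : ℕ} (hn : 2 ≤ n) (hφ : φ ∈ orderGE n) :
    KillsTorsion (φ.1 n) := by
  intro y hy
  obtain ⟨x, rfl⟩ := exists_circle_pow_eq y n.factorial_ne_zero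
  have hx : IsOfFinOrder x := (isOfFinOrder_pow.1 hy).resolve_right n.factorial_ne_zero
  rw [((mem_calH_iff_choose _).1 φ.2).2 n x 0 hx (by rw [hφ 1 one_ne_zero (by omega)]; simp),
    Ring.choose_zero_pos ℤ (by omega), zpow_zero]

/-- The element `1 + β tᵠ` of `𝓗`, for an endomorphism `β` that kills torsion. -/
theorem exists_orderGE_apply_eq {q : ℕ} (hq : q ≠ 0) {β : Circle →* Circle}
    (hβ : KillsTorsion β) : ∃ φ ∈ orderGE q, φ.1 q = β := by
  classical
  let f : ℕ → (Circle →* Circle) := fun k =>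
    if k = 0 then MonoidHom.id Circle else if k = q then β else 1
  have hf : ∀ k, k ≠ 0 → KillsTorsion (f k) := by
    intro k hk x hx
    simp only [f, if_neg hk]
    split_ifs
    · exact hβ x hx
    · rfl
  refine ⟨⟨f, (mem_calH_iff_choose f).2 ⟨rfl, fun k x m hx hm => ?_⟩⟩, fun k hk hkq => ?_, ?_⟩
  · rcases eq_or_ne k 0 with rfl | hk
    · simp [f]
    · have h1 := ((mem_calH_iff_choose _).1 convOne_mem_calH).2 k x m hx
        (by rw [← hm, hf 1 one_ne_zero x hx]; rfl)
      rw [← h1, hf k hk _ hx.pow]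
      simp [convOne, hk]
  · simp only [f, if_neg hk, if_neg hkq.ne]
  · simp [f, hq]

/-- The coefficients at `q` of the elements of order at least `q` of a subgroup of `𝓗`. -/
def leadingSubgroup (N : Subgroup calH) {q : ℕ} (hq : q ≠ 0) : Subgroup (Circle →* Circle) where
  carrier := {γ | ∃ κ ∈ N, κ ∈ orderGE q ∧ κ.1 q = γ}
  one_mem' := ⟨1, N.one_mem, fun k hk _ => calH_one_apply hk, calH_one_apply hq⟩
  mul_mem' := by
    rintro _ _ ⟨a, ha, ha', rfl⟩ ⟨b, hb, hb', rfl⟩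
    exact ⟨a * b, N.mul_mem ha hb, orderGE_mul ha' hb', mul_apply_of_orderGE_left b ha' hq le_rfl⟩
  inv_mem' := by
    rintro _ ⟨a, ha, ha', rfl⟩
    exact ⟨a⁻¹, N.inv_mem ha, orderGE_inv ha', inv_apply_of_orderGE ha' hq⟩

theorem isClosed_orderGE (q : ℕ) : IsClosed (orderGE q) := by
  simp only [orderGE, Set.ofPred_forall]
  exact isClosed_iInter fun k => isClosed_iInter fun _ => isClosed_iInter fun _ =>
    isClosed_eq (continuous_coeff_calH k) continuous_const

theorem isClosed_leadingSubgroup {N : Subgroup calH} (hN : IsClosed (N : Set calH)) {q : ℕ}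
    (hq : q ≠ 0) : IsClosed (leadingSubgroup N hq : Set (Circle →* Circle)) := by
  have h : (leadingSubgroup N hq : Set (Circle →* Circle)) =
      (fun φ : calH => φ.1 q) '' ((N : Set calH) ∩ orderGE q) := by
    ext γ
    constructor
    · rintro ⟨κ, h1, h2, h3⟩
      exact ⟨κ, ⟨h1, h2⟩, h3⟩
    · rintro ⟨κ, ⟨h1, h2⟩, h3⟩
      exact ⟨κ, h1, h2, h3⟩
  rw [h]
  exact ((hN.inter (isClosed_orderGE q)).isCompact.image (continuous_coeff_calH q)).isClosed

/-- A closed subgroup realizes all torsion-killing endomorphisms as leading coefficients as soon as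
it contains enough commutators with an element whose leading coefficient is not a power map. -/
theorem exists_mem_orderGE_add {N : Subgroup calH} (hN : IsClosed (N : Set calH)) {ν : calH}
    {r q : ℕ} (hν : ν ∈ orderGE r) (hr : r ≠ 0) (hq : q ≠ 0)
    (hc : ¬ ∃ c : ℤ, ∀ x, ν.1 r x = x ^ c)
    (hcomm : ∀ β : Circle →* Circle, KillsTorsion β →
      ∃ φ ∈ orderGE q, φ.1 q = β ∧ ν * φ * (φ * ν)⁻¹ ∈ N)
    {γ : Circle →* Circle} (hγ : KillsTorsion γ) :
    ∃ κ ∈ N, κ ∈ orderGE (r + q) ∧ κ.1 (r + q) = γ := by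
  have hrq : r + q ≠ 0 := by omega
  refine mem_of_forall_apply_eq_one (isClosed_leadingSubgroup hN hrq) (φ := γ) fun w hw => hγ w ?_
  by_contra hwt
  -- At a point `w` annihilating the leading subgroup, the leading ring commutators vanish, so `ν_r`
  -- and each `β` commute there.
  refine hc (exists_eq_zpow_of_commute (ν.1 r) hwt fun β hβ => ?_)
  obtain ⟨φ, hφ, rfl, hmem⟩ := hcomm β hβ
  obtain ⟨h1, h2⟩ := commutator_orderGE hν hφ hr hq
  have h3 := hw _ ⟨_, hmem, h1, rfl⟩
  rw [h2] at h3
  exact mul_inv_eq_one.1 h3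

/-- Successive approximation: the discrepancy beyond degree `m` is removed one coefficient at a
time, and the corrected elements of `N` converge coefficientwise to `φ`. -/
theorem mem_of_forall_exists_leading {N : Subgroup calH} (hN : IsClosed (N : Set calH)) {m : ℕ}
    (hm : m ≠ 0)
    (h : ∀ q, m < q → ∀ γ : Circle →* Circle, KillsTorsion γ →
      ∃ κ ∈ N, κ ∈ orderGE q ∧ κ.1 q = γ)
    {φ ν : calH} (hν : ν ∈ N) (hφ : φ * ν⁻¹ ∈ orderGE (m + 1)) : φ ∈ N := by
  have happ : ∀ j : ℕ, ∃ ν ∈ N, φ * ν⁻¹ ∈ orderGE (m + 1 + j) := by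
    intro j
    induction j with
    | zero => exact ⟨ν, hν, hφ⟩
    | succ j ih =>
      obtain ⟨ν, hν, hord⟩ := ih
      obtain ⟨κ, hκ, hκo, hκe⟩ := h (m + 1 + j) (by omega) _
        (killsTorsion_apply_of_orderGE (by omega) hord)
      have hne : m + 1 + j ≠ 0 := by omega
      refine ⟨κ * ν, N.mul_mem hκ hν, ?_⟩
      rw [mul_inv_rev, ← mul_assoc]
      refine orderGE_succ (r := m + 1 + j) (orderGE_mul hord (orderGE_inv hκo)) ?_
      rw [mul_apply_of_orderGE_left _ hord hne le_rfl, inv_apply_of_orderGE hκo hne, hκe,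
        mul_inv_cancel]
  choose u hu hord using happ
  have hlim : Tendsto u atTop (𝓝 φ) := by
    rw [tendsto_subtype_rng, tendsto_pi_nhds]
    intro k
    refine tendsto_const_nhds.congr' ?_
    filter_upwards [eventually_ge_atTop k] with j hj
    rcases eq_or_ne k 0 with rfl | hk
    · rw [calH_apply_zero, calH_apply_zero]
    · have h1 := mul_apply_of_orderGE_left (u j) (hord j) hk (by omega)
      rw [inv_mul_cancel_right, hord j k hk (by omega), one_mul] at h1
      exact h1
  exact hN.mem_of_tendsto hlim (Eventually.of_forall hu)

/-! ### Density of the powers of `1 + t`. -/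

/-- The element `1 + t` of `𝓗`. -/
noncomputable def tau : calH := calT 1

theorem calT_apply_succ (φ : calH) (k : ℕ) : (calT φ).1 (k + 1) = φ.1 k * φ.1 (k + 1) := rfl

theorem tau_apply_one : tau.1 1 = MonoidHom.id Circle := mul_one _

theorem calT_eq_tau_mul (φ : calH) : calT φ = tau * φ := by
  refine Subtype.ext (funext fun k => ?_)
  cases k with
  | zero => rw [calH_apply_zero, calH_apply_zero]
  | succ k =>
    ext1 x
    rw [calT_apply_succ, calH_mul_apply, Finset.Nat.prod_antidiagonal_succ, MonoidHom.mul_apply,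
      mul_comm, calH_apply_zero]
    congr 1
    cases k with
    | zero => simp [tau_apply_one, calH_apply_zero]
    | succ k =>
      rw [Finset.Nat.prod_antidiagonal_succ]
      simp only [zero_add, tau_apply_one, MonoidHom.id_apply]
      rw [Finset.prod_eq_one, mul_one]
      intro p hp
      have : tau.1 (p.1 + 1 + 1) = 1 := mul_one _
      rw [this, MonoidHom.one_apply]

theorem calT_zpow_apply (n : ℤ) (φ : calH) : (calT ^ n) φ = tau ^ n * φ := by
  have hnat : ∀ (n : ℕ) (φ : calH), (calT ^ n) φ = tau ^ n * φ := by
    intro n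
    induction n with
    | zero => intro φ; simp
    | succ n ih =>
      intro φ
      rw [pow_succ, pow_succ, mul_assoc, ← calT_eq_tau_mul, ← ih]
      rfl
  cases n with
  | ofNat n => simpa using hnat n φ
  | negSucc n =>
    rw [zpow_negSucc, zpow_negSucc, eq_inv_mul_iff_mul_eq, ← hnat]
    exact (calT ^ (n + 1)).apply_symm_apply φ

theorem continuous_tau_zpow_mul (n : ℤ) : Continuous fun φ : calH => tau ^ n * φ := by
  simp only [← calT_zpow_apply]
  exact (calT ^ n).continuous

/-- Left multiplication is known to be continuous only for powers of `tau`, so the closure is taken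
first in the right factor, then in the left. -/
theorem mul_mem_closure_zpowers {a b : calH}
    (ha : a ∈ closure (Subgroup.zpowers tau : Set calH))
    (hb : b ∈ closure (Subgroup.zpowers tau : Set calH)) :
    a * b ∈ closure (Subgroup.zpowers tau : Set calH) := by
  have h := closure_minimal (s := (Subgroup.zpowers tau : Set calH))
    (t := (fun a => a * b) ⁻¹' closure (Subgroup.zpowers tau : Set calH))
    ?_ (isClosed_closure.preimage (continuous_mul_right_calH b))
  · exact h ha
  · rintro _ ⟨n, rfl⟩
    exact map_mem_closure (continuous_tau_zpow_mul n) hb fun c hc =>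
      (Subgroup.zpowers tau).mul_mem ⟨n, rfl⟩ hc

/-- Ellis' argument: the compact subsemigroup consisting of the products `b * a` contains an
idempotent, which in a group is 1. -/
theorem inv_mem_closure_zpowers {a : calH}
    (ha : a ∈ closure (Subgroup.zpowers tau : Set calH)) :
    a⁻¹ ∈ closure (Subgroup.zpowers tau : Set calH) := by
  obtain ⟨_, ⟨b, hb, rfl⟩, hm⟩ := exists_idempotent_in_compact_subsemigroup
    continuous_mul_right_calH ((fun b => b * a) '' closure (Subgroup.zpowers tau : Set calH))
    (Set.Nonempty.image _ ⟨a, ha⟩)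
    (isClosed_closure.isCompact.image (continuous_mul_right_calH a)) (by
      rintro _ ⟨b, hb, rfl⟩ _ ⟨c, hc, rfl⟩
      exact ⟨b * a * c, mul_mem_closure_zpowers (mul_mem_closure_zpowers hb ha) hc,
        mul_assoc _ _ _⟩)
  have h1 : b * a = 1 := mul_eq_left.1 hm
  rwa [← eq_inv_of_mul_eq_one_left h1]

/-- The closure of the powers of `1 + t`, as a subgroup. -/
def closureZpowers : Subgroup calH where
  carrier := closure (Subgroup.zpowers tau : Set calH)
  one_mem' := subset_closure (Subgroup.one_mem _)
  mul_mem' := mul_mem_closure_zpowers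
  inv_mem' := inv_mem_closure_zpowers

/-- Already `tau` contributes the identity as a first coefficient, so only `w = 1` is annihilated
and duality gives everything. -/
theorem exists_mem_closureZpowers_apply_one (α : Circle →* Circle) :
    ∃ ψ ∈ closureZpowers, ψ.1 1 = α := by
  obtain ⟨κ, hκ, -, h⟩ := mem_of_forall_apply_eq_one
    (isClosed_leadingSubgroup (N := closureZpowers) isClosed_closure one_ne_zero) (φ := α)
    fun w hw => by
      have h1 : w = 1 := hw _ ⟨tau, subset_closure (Subgroup.mem_zpowers _), orderGE_one _,
        tau_apply_one⟩
      rw [h1, map_one]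
  exact ⟨κ, hκ, h⟩

/-- A power map that kills all roots of unity is trivial, whereas a torsion-killing `β` may fix a
point of infinite order. -/
theorem exists_killsTorsion_not_zpow :
    ∃ β : Circle →* Circle, KillsTorsion β ∧ ¬ ∃ c : ℤ, ∀ x, β x = x ^ c := by
  obtain ⟨w, hw⟩ := exists_not_isOfFinOrder_circle
  obtain ⟨β, hβ, hβw⟩ := exists_killsTorsion_apply_eq hw w
  refine ⟨β, hβ, ?_⟩
  rintro ⟨c, hc⟩
  have : NeZero (c.natAbs + 1) := ⟨by omega⟩
  obtain ⟨ζ, hζ⟩ := exists_circle_orderOf_eq (c.natAbs + 1)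
  have h1 : ζ ^ c = 1 := by
    rw [← hc]
    exact hβ ζ (isOfFinOrder_iff_pow_eq_one.2 ⟨_, Nat.succ_pos _, hζ.pow_eq_one⟩)
  have h2 := Int.natAbs_dvd_natAbs.2 ((hζ.zpow_eq_one_iff_dvd c).1 h1)
  rw [Int.natAbs_natCast] at h2
  have h3 : c.natAbs = 0 := Nat.eq_zero_of_dvd_of_lt h2 (Nat.lt_succ_self _)
  have h4 : c = 0 := Int.natAbs_eq_zero.1 h3
  have h5 := hc w
  rw [hβw, h4, zpow_zero] at h5
  exact hw (h5 ▸ IsOfFinOrder.one)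

/-- The orbit of `1` is dense in `𝓗`. -/
theorem dense_zpowers_tau : Dense (Subgroup.zpowers tau : Set calH) := by
  obtain ⟨β, hβ, hβc⟩ := exists_killsTorsion_not_zpow
  obtain ⟨ν, hν, rfl⟩ := exists_mem_closureZpowers_apply_one β
  have hlead : ∀ q, q ≠ 0 → ∀ γ : Circle →* Circle, KillsTorsion γ →
      ∃ κ ∈ closureZpowers, κ ∈ orderGE q ∧ κ.1 q = γ := by
    intro q hq
    induction q with
    | zero => exact absurd rfl hq
    | succ q ih =>
      intro γ hγ
      rcases eq_or_ne q 0 with rfl | hq0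
      · obtain ⟨ψ, hψ, h⟩ := exists_mem_closureZpowers_apply_one γ
        exact ⟨ψ, hψ, orderGE_one _, h⟩
      · rw [add_comm q 1]
        refine exists_mem_orderGE_add isClosed_closure (orderGE_one ν) one_ne_zero hq0 hβc ?_ hγ
        intro β' hβ'
        obtain ⟨φ, hφ, hφo, h⟩ := ih hq0 β' hβ'
        exact ⟨φ, hφo, h, Subgroup.mul_mem _ (Subgroup.mul_mem _ hν hφ)
          (Subgroup.inv_mem _ (Subgroup.mul_mem _ hφ hν))⟩
  intro φ
  obtain ⟨ψ, hψ, h⟩ := exists_mem_closureZpowers_apply_one (φ.1 1)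
  refine mem_of_forall_exists_leading (N := closureZpowers) isClosed_closure one_ne_zero
    (fun q hq => hlead q (by omega)) hψ (mul_inv_apply_of_forall_lt fun k hk => ?_).1
  interval_cases k
  · rw [calH_apply_zero, calH_apply_zero]
  · exact h

/-! ### Closed normal subgroups and invariant evaluations. -/

section Separation

variable {N : Subgroup calH} [N.Normal]

theorem exists_leading_of_normal (hN : IsClosed (N : Set calH)) {m : ℕ} (hm : m ≠ 0)
    (hord : ∀ ν ∈ N, ν ∈ orderGE m) (hne : ∃ ν ∈ N, ν.1 m ≠ 1) {q : ℕ} (hq : m < q)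
    {γ : Circle →* Circle} (hγ : KillsTorsion γ) : ∃ κ ∈ N, κ ∈ orderGE q ∧ κ.1 q = γ := by
  obtain ⟨ν, hν, hc⟩ : ∃ ν ∈ N, ¬ ∃ c : ℤ, ∀ x, ν.1 m x = x ^ c := by
    by_contra hall
    push Not at hall
    obtain ⟨β, hβ, hβc⟩ := exists_killsTorsion_not_zpow
    obtain ⟨ν, hν, hν1⟩ := hne
    obtain ⟨c, hc⟩ := hall ν hν
    have hc0 : c ≠ 0 := by
      rintro rfl
      exact hν1 (MonoidHom.ext fun x => by rw [hc, zpow_zero, MonoidHom.one_apply])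
    -- If `x ↦ x^c` with `c ≠ 0` is a leading coefficient, the annihilator is `c`-torsion, so by
    -- duality `β` would be one too.
    obtain ⟨κ, hκ, -, rfl⟩ := mem_of_forall_apply_eq_one (isClosed_leadingSubgroup hN hm) (φ := β)
      fun w hw => hβ w (isOfFinOrder_iff_zpow_eq_one.2
        ⟨c, hc0, by rw [← hc, hw _ ⟨ν, hν, hord ν hν, rfl⟩]⟩)
    exact hβc (hall κ hκ)
  obtain ⟨d, rfl⟩ := Nat.exists_eq_add_of_lt hq
  refine exists_mem_orderGE_add (q := d + 1) hN (hord ν hν) hm d.succ_ne_zero hc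
    (fun β hβ => ?_) hγ
  obtain ⟨φ, hφ, h⟩ := exists_orderGE_apply_eq d.succ_ne_zero hβ
  refine ⟨φ, hφ, h, ?_⟩
  -- The commutator is `ν` times a conjugate of `ν⁻¹`, hence in `N`.
  rw [mul_inv_rev, mul_assoc, ← mul_assoc φ]
  exact N.mul_mem hν (Subgroup.Normal.conj_mem inferInstance _ (N.inv_mem hν) φ)

/-- The characters of `𝓗` that are invariant under a closed normal subgroup separate its cosets. -/
theorem exists_invariant_eval_ne (hN : IsClosed (N : Set calH)) {φ : calH} (hφ : φ ∉ N) :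
    ∃ k : ℕ, ∃ x, (∀ a, ∀ ν ∈ N, (a * ν).1 k x = a.1 k x) ∧ ∀ a, (a * φ).1 k x ≠ a.1 k x := by
  classical
  -- The least degree `m` at which `φ` or some element of `N` is nontrivial: there coefficients
  -- multiply, so evaluation in degree `m` is additive in leading terms.
  have hex : ∃ k, k ≠ 0 ∧ ∃ ν : calH, (ν ∈ N ∨ ν = φ) ∧ ν.1 k ≠ 1 := by
    by_contra hno
    push Not at hno
    refine hφ ?_
    have h1 : φ = 1 := Subtype.ext (funext fun k => by
      rcases eq_or_ne k 0 with rfl | hk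
      · rw [calH_apply_zero, calH_apply_zero]
      · rw [hno k hk φ (Or.inr rfl), calH_one_apply hk])
    rw [h1]
    exact N.one_mem
  obtain ⟨hm, hne⟩ := Nat.find_spec hex
  have hmin := fun k (hk : k < Nat.find hex) => Nat.find_min hex hk
  generalize Nat.find hex = m at hm hne hmin
  have hord : ∀ ν : calH, (ν ∈ N ∨ ν = φ) → ν ∈ orderGE m := fun ν hν k hk hkm => by
    by_contra h
    exact hmin k hkm ⟨hk, ν, hν, h⟩
  obtain ⟨w, hw, hwφ⟩ : ∃ w, (∀ ν ∈ N, ν.1 m w = 1) ∧ φ.1 m w ≠ 1 := by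
    by_cases htriv : ∀ ν ∈ N, ν.1 m = 1
    · obtain ⟨ν, hν | rfl, h⟩ := hne
      · exact absurd (htriv ν hν) h
      · obtain ⟨w, hw⟩ := DFunLike.ne_iff.1 h
        exact ⟨w, fun κ hκ => by rw [htriv κ hκ, MonoidHom.one_apply], hw⟩
    · push Not at htriv
      by_contra hno
      push Not at hno
      obtain ⟨κ, hκ, hκo, h⟩ := mem_of_forall_apply_eq_one (isClosed_leadingSubgroup hN hm)
        (φ := φ.1 m) fun w hw => hno w fun ν hν => hw _ ⟨ν, hν, hord ν (Or.inl hν), rfl⟩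
      -- Otherwise some `κ ∈ N` agrees with `φ` through degree `m`, and the leading coefficients
      -- available in `N` remove the rest.
      refine hφ (mem_of_forall_exists_leading hN hm (fun q hq γ hγ => exists_leading_of_normal hN hm
        (fun ν hν => hord ν (Or.inl hν)) htriv hq hγ) hκ ?_)
      refine (mul_inv_apply_of_forall_lt fun k hk => ?_).1
      rcases eq_or_ne k 0 with rfl | hk0
      · rw [calH_apply_zero, calH_apply_zero]
      · rcases Nat.lt_succ_iff_lt_or_eq.1 hk with hk' | rfl
        · rw [hκo k hk0 hk', hord φ (Or.inr rfl) k hk0 hk']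
        · exact h
  refine ⟨m, w, fun a ν hν => ?_, fun a h => hwφ ?_⟩
  · rw [mul_apply_of_orderGE_right a (hord ν (Or.inl hν)) hm le_rfl, MonoidHom.mul_apply,
      hw ν hν, mul_one]
  · rw [mul_apply_of_orderGE_right a (hord φ (Or.inr rfl)) hm le_rfl, MonoidHom.mul_apply] at h
    exact mul_eq_left.1 h

end Separation

/-! ### Quasi-eigenfunctions and point separation. -/

section QuasiEigenfunctions

variable {X : Type*} [TopologicalSpace X] (s : X ≃ₜ X)

theorem one_mem_quasiEigenfunctions (m : ℕ) : (1 : C(X, Circle)) ∈ quasiEigenfunctions s m := by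
  induction m with
  | zero => exact ⟨1, fun x => rfl⟩
  | succ m ih => exact ⟨1, ih, fun x => by simp⟩

theorem mul_mem_quasiEigenfunctions {m : ℕ} {f g : C(X, Circle)}
    (hf : f ∈ quasiEigenfunctions s m) (hg : g ∈ quasiEigenfunctions s m) :
    f * g ∈ quasiEigenfunctions s m := by
  induction m generalizing f g with
  | zero =>
    obtain ⟨a, ha⟩ := hf
    obtain ⟨b, hb⟩ := hg
    exact ⟨a * b, fun x => by simp [ha, hb]⟩
  | succ m ih =>
    obtain ⟨f', hf', h⟩ := hf
    obtain ⟨g', hg', h'⟩ := hg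
    exact ⟨f' * g', ih hf' hg', fun x => by
      simp only [ContinuousMap.mul_apply, h, h', mul_mul_mul_comm]⟩

theorem inv_mem_quasiEigenfunctions {m : ℕ} {f : C(X, Circle)}
    (hf : f ∈ quasiEigenfunctions s m) : f⁻¹ ∈ quasiEigenfunctions s m := by
  induction m generalizing f with
  | zero =>
    obtain ⟨a, ha⟩ := hf
    exact ⟨a⁻¹, fun x => by simp [ha]⟩
  | succ m ih =>
    obtain ⟨f', hf', h⟩ := hf
    exact ⟨f'⁻¹, ih hf', fun x => by simp only [ContinuousMap.inv_apply, h, mul_inv]⟩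

theorem quasiEigenfunctions_subset_succ (m : ℕ) :
    quasiEigenfunctions s m ⊆ quasiEigenfunctions s (m + 1) := by
  induction m with
  | zero =>
    rintro f ⟨c, hc⟩
    exact ⟨1, one_mem_quasiEigenfunctions s 0, fun x => by simp [hc]⟩
  | succ m ih =>
    rintro f ⟨g, hg, h⟩
    exact ⟨g, ih hg, h⟩

/-- The group of all quasi-eigenfunctions. -/
def quasiEigenfunctionGroup : Subgroup C(X, Circle) where
  carrier := {g | ∃ m, g ∈ quasiEigenfunctions s m}
  one_mem' := ⟨0, one_mem_quasiEigenfunctions s 0⟩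
  mul_mem' := by
    rintro f g ⟨m, hf⟩ ⟨n, hg⟩
    have hmono := monotone_nat_of_le_succ (quasiEigenfunctions_subset_succ s)
    exact ⟨max m n, mul_mem_quasiEigenfunctions s (hmono (le_max_left m n) hf)
      (hmono (le_max_right m n) hg)⟩
  inv_mem' := by
    rintro f ⟨m, hf⟩
    exact ⟨m, inv_mem_quasiEigenfunctions s hf⟩

theorem hasQuasiDiscreteSpectrum_of_separatesPoints [CompactSpace X]
    (h : ∀ a b : X, (∀ m, ∀ g ∈ quasiEigenfunctions s m, g a = g b) → a = b) :
    HasQuasiDiscreteSpectrum s := by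
  have hset : {F : C(X, ℂ) | ∃ m : ℕ, ∃ g ∈ quasiEigenfunctions s m, ∀ x, F x = (g x : ℂ)} =
      {F | ∃ g ∈ quasiEigenfunctionGroup s, ∀ x, F x = (g x : ℂ)} := by
    ext F
    constructor
    · rintro ⟨m, g, hg, hF⟩
      exact ⟨g, ⟨m, hg⟩, hF⟩
    · rintro ⟨g, ⟨m, hg⟩, hF⟩
      exact ⟨m, g, hg, hF⟩
  rw [HasQuasiDiscreteSpectrum, hset]
  exact dense_span_of_separatesPoints (quasiEigenfunctionGroup s) fun a b hab =>
    h a b fun m g hg => hab g ⟨m, hg⟩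

theorem separatesPoints_of_hasQuasiDiscreteSpectrum [CompactSpace X] [T2Space X]
    (h : HasQuasiDiscreteSpectrum s) {a b : X}
    (hab : ∀ m, ∀ g ∈ quasiEigenfunctions s m, g a = g b) : a = b := by
  by_contra hne
  obtain ⟨f, hf0, hf1, -⟩ := exists_continuous_zero_one_of_isClosed (s := {a}) (t := {b})
    isClosed_singleton isClosed_singleton (by simpa using hne)
  let F : C(X, ℂ) := ⟨fun x => (f x : ℂ), by fun_prop⟩
  have heq : (ContinuousMap.evalCLM ℂ a : C(X, ℂ) →L[ℂ] ℂ) = ContinuousMap.evalCLM ℂ b := by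
    refine ContinuousLinearMap.ext_on h ?_
    rintro G ⟨m, g, hg, hG⟩
    simp [hG, hab m g hg]
  have h1 : F a = F b := DFunLike.congr_fun heq F
  have ha : f a = 0 := hf0 rfl
  have hb : f b = 1 := hf1 rfl
  simp [F, ha, hb] at h1

end QuasiEigenfunctions

theorem exists_quasiEigenfunction_lift {E : Type*} [TopologicalSpace E] [T2Space E]
    {t : E ≃ₜ E} {Φ : calH → E} (hΦ : Continuous Φ) (hsurj : Function.Surjective Φ)
    (heq : ∀ ψ, Φ (calT ψ) = t (Φ ψ)) (k : ℕ) (x : Circle)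
    (hinv : ∀ ψ ψ', Φ ψ = Φ ψ' → ψ.1 k x = ψ'.1 k x) :
    ∃ g ∈ quasiEigenfunctions t k, ∀ ψ, g (Φ ψ) = ψ.1 k x := by
  induction k with
  | zero =>
    exact ⟨ContinuousMap.const _ x, ⟨x, fun _ => rfl⟩, fun ψ => by
      rw [calH_apply_zero]; rfl⟩
  | succ k ih =>
    have hquot : IsQuotientMap Φ := hΦ.isClosedMap.isQuotientMap hΦ hsurj
    -- Degree `k` is recovered from degree `k + 1` and `T`, so constancy on the fibres of `Φ` passes
    -- downwards.
    have hT : ∀ ψ : calH, ψ.1 k x = (calT ψ).1 (k + 1) x * (ψ.1 (k + 1) x)⁻¹ := fun ψ => by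
      rw [calT_apply_succ, MonoidHom.mul_apply, mul_inv_cancel_right]
    obtain ⟨f, hf, hfe⟩ := ih fun ψ ψ' h => by
      rw [hT, hT, hinv ψ ψ' h, hinv (calT ψ) (calT ψ') (by rw [heq, heq, h])]
    let G : C(calH, Circle) := ⟨fun ψ => ψ.1 (k + 1) x, continuous_eval_calH _ _⟩
    let g : C(E, Circle) := hquot.lift (f := ⟨Φ, hΦ⟩) G fun ψ ψ' h => hinv ψ ψ' h
    have hg : ∀ ψ, g (Φ ψ) = ψ.1 (k + 1) x := fun ψ =>
      DFunLike.congr_fun (hquot.lift_comp (f := ⟨Φ, hΦ⟩) G fun ψ ψ' h => hinv ψ ψ' h) ψ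
    refine ⟨g, ⟨f, hf, fun y => ?_⟩, hg⟩
    obtain ⟨ψ, rfl⟩ := hsurj y
    rw [← heq, hg, hg, hfe, calT_apply_succ, MonoidHom.mul_apply]

/-- Quotients of `𝓗` by closed normal subgroups have quasi-discrete spectrum. -/
theorem hasQuasiDiscreteSpectrum_of_quotient {E : Type*} [TopologicalSpace E] [T2Space E]
    [CompactSpace E] {t : E ≃ₜ E} {Φ : calH → E} (hΦ : Continuous Φ)
    (hsurj : Function.Surjective Φ) (heq : ∀ ψ, Φ (calT ψ) = t (Φ ψ)) {N : Subgroup calH}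
    [N.Normal] (hN : IsClosed (N : Set calH)) (hker : ∀ ψ ψ', Φ ψ = Φ ψ' ↔ ψ⁻¹ * ψ' ∈ N) :
    HasQuasiDiscreteSpectrum t := by
  refine hasQuasiDiscreteSpectrum_of_separatesPoints t fun a b hab => ?_
  obtain ⟨ψ, rfl⟩ := hsurj a
  obtain ⟨ψ', rfl⟩ := hsurj b
  by_contra hne
  obtain ⟨k, x, hinv, hsep⟩ := exists_invariant_eval_ne hN fun h => hne ((hker ψ ψ').2 h)
  obtain ⟨g, hg, hge⟩ := exists_quasiEigenfunction_lift hΦ hsurj heq k x fun a a' h => by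
    rw [← hinv a _ ((hker a a').1 h), mul_inv_cancel_left]
  have h1 := hab k g hg
  rw [hge, hge] at h1
  refine hsep ψ ?_
  rw [mul_inv_cancel_left, h1]

/-! ### Enveloping semigroups of factors of `calH`. -/

theorem zpow_apply_of_semiconj {X Y : Type*} [TopologicalSpace X] [TopologicalSpace Y]
    {s : X ≃ₜ X} {t : Y ≃ₜ Y} {π : X → Y} (h : ∀ x, π (s x) = t (π x)) (n : ℤ) (x : X) :
    π ((s ^ n) x) = (t ^ n) (π x) := by
  have hnat : ∀ (n : ℕ) (x : X), π ((s ^ n) x) = (t ^ n) (π x) := by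
    intro n
    induction n with
    | zero => intro x; rfl
    | succ n ih =>
      intro x
      rw [pow_succ, pow_succ]
      exact (ih (s x)).trans (congrArg _ (h x))
  cases n with
  | ofNat n => simpa using hnat n x
  | negSucc n =>
    rw [zpow_negSucc, zpow_negSucc]
    refine ((t ^ (n + 1)).symm_apply_apply _).symm.trans (congrArg (t ^ (n + 1)).symm ?_)
    rw [← hnat]
    exact congrArg π ((s ^ (n + 1)).apply_symm_apply x)

section Factor

variable {X : Type*} [TopologicalSpace X] [T2Space X] {s : X ≃ₜ X}

theorem hasQuasiDiscreteSpectrum_envelopingTranslation_of_isFactor [CompactSpace X]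
    (h : IsFactor s calT) : HasQuasiDiscreteSpectrum (envelopingTranslation s) := by
  obtain ⟨π, hπ, hsurj, heq⟩ := h
  have hz : ∀ (n : ℤ) (φ : calH), π (tau ^ n * φ) = (s ^ n) (π φ) := fun n φ => by
    rw [← calT_zpow_apply, zpow_apply_of_semiconj heq]
  have hmulc : ∀ φ : calH, Continuous fun ψ : calH => π (ψ * φ) := fun φ =>
    hπ.comp (continuous_mul_right_calH φ)
  -- Left multiplication respects the fibres of `π`: clear for powers of `tau`, and in general by
  -- density. Hence `calH` acts on `X`.
  have hwd : ∀ ψ φ φ' : calH, π φ = π φ' → π (ψ * φ) = π (ψ * φ') := by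
    intro ψ φ φ' h
    refine (isClosed_eq (hmulc φ) (hmulc φ')).closure_subset_iff.2 ?_ (dense_zpowers_tau ψ)
    rintro _ ⟨n, rfl⟩
    exact (hz n φ).trans ((congrArg _ h).trans (hz n φ').symm)
  let F : calH → X → X := fun ψ y => π (ψ * Function.surjInv hsurj y)
  have hF : ∀ ψ φ : calH, F ψ (π φ) = π (ψ * φ) := fun ψ φ =>
    hwd ψ _ _ (Function.surjInv_eq hsurj _)
  have hFc : Continuous F := continuous_pi fun y => hmulc _
  have hFz : ∀ n : ℤ, F (tau ^ n) = ((s ^ n : X ≃ₜ X) : X → X) := fun n => by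
    funext y
    obtain ⟨φ, rfl⟩ := hsurj y
    rw [hF, hz]
  have hFmul : ∀ a b : calH, F (a * b) = F a ∘ F b := fun a b => by
    funext y
    obtain ⟨φ, rfl⟩ := hsurj y
    rw [Function.comp_apply, hF, hF b, hF a, mul_assoc]
  have hF1 : F 1 = id := by
    funext y
    obtain ⟨φ, rfl⟩ := hsurj y
    rw [hF, one_mul, id]
  have hFmem : ∀ ψ, F ψ ∈ envelopingSemigroup s := fun ψ =>
    map_mem_closure hFc (dense_zpowers_tau ψ) (by
      rintro _ ⟨n, rfl⟩
      exact ⟨n, (hFz n).symm⟩)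
  have hrange : envelopingSemigroup s ⊆ Set.range F :=
    closure_minimal (by
      rintro _ ⟨n, rfl⟩
      exact ⟨tau ^ n, hFz n⟩) (isCompact_range hFc).isClosed
  have : CompactSpace (envelopingSemigroup s) :=
    isCompact_iff_compactSpace.1 isClosed_closure.isCompact
  let N : Subgroup calH :=
    { carrier := {ν | F ν = id}
      one_mem' := hF1
      mul_mem' := by
        intro a b (ha : F a = id) (hb : F b = id)
        change F (a * b) = id
        rw [hFmul, ha, hb, Function.comp_id]
      inv_mem' := by
        intro a (ha : F a = id)
        change F a⁻¹ = id
        have h1 := hFmul a⁻¹ a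
        rw [inv_mul_cancel, hF1, ha, Function.comp_id] at h1
        exact h1.symm }
  have : N.Normal := ⟨fun ν (hν : F ν = id) a => by
    change F (a * ν * a⁻¹) = id
    rw [hFmul, hFmul, hν, Function.comp_id, ← hFmul, mul_inv_cancel, hF1]⟩
  refine hasQuasiDiscreteSpectrum_of_quotient (Φ := fun ψ => ⟨F ψ, hFmem ψ⟩) (N := N)
    (hFc.subtype_mk _) ?_ ?_ (isClosed_eq hFc continuous_const) ?_
  · rintro ⟨a, ha⟩
    obtain ⟨ψ, rfl⟩ := hrange ha
    exact ⟨ψ, rfl⟩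
  · intro ψ
    refine Subtype.ext ?_
    change F (calT ψ) = s ∘ F ψ
    have h1 := hFz 1
    rw [zpow_one, zpow_one] at h1
    rw [calT_eq_tau_mul, hFmul, h1]
  · intro ψ ψ'
    rw [Subtype.mk.injEq]
    constructor
    · intro h
      change F (ψ⁻¹ * ψ') = id
      rw [hFmul, ← h, ← hFmul, inv_mul_cancel, hF1]
    · intro (h : F (ψ⁻¹ * ψ') = id)
      rw [← mul_inv_cancel_left ψ ψ', hFmul, h, Function.comp_id]

end Factor

theorem IsFactor.trans {X Y Z : Type*} [TopologicalSpace X] [TopologicalSpace Y]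
    [TopologicalSpace Z] {s : X ≃ₜ X} {t : Y ≃ₜ Y} {u : Z ≃ₜ Z} (h : IsFactor s t)
    (h' : IsFactor t u) : IsFactor s u := by
  obtain ⟨π, hπ, hs, he⟩ := h
  obtain ⟨ρ, hρ, hs', he'⟩ := h'
  exact ⟨π ∘ ρ, hπ.comp hρ, hs.comp hs', fun x => by simp [he, he']⟩

/-! ### Point-transitive systems with quasi-discrete spectrum. -/

theorem tau_zpow_add_one_apply_succ (n : ℤ) (k : ℕ) :
    (tau ^ (n + 1)).1 (k + 1) = (tau ^ n).1 k * (tau ^ n).1 (k + 1) := by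
  rw [add_comm n 1, zpow_one_add, ← calT_eq_tau_mul, calT_apply_succ]

/-- Pascal's rule for the coefficients of `τ^n` solves the recursion `g(t^{n+1}e) = f(t^n e) g(t^n
e)`: the constants of `f` move up one degree, and `g e` enters in degree 0. -/
theorem quasiEigenfunction_orbit {E : Type*} [TopologicalSpace E] (t : E ≃ₜ E) (e : E) {m : ℕ}
    {g : C(E, Circle)} (hg : g ∈ quasiEigenfunctions t m) :
    ∃ c : ℕ → Circle, ∀ n : ℤ,
      g ((t ^ n) e) = ∏ j ∈ Finset.range (m + 1), (tau ^ n).1 j (c j) := by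
  induction m generalizing g with
  | zero =>
    obtain ⟨c, hc⟩ := hg
    exact ⟨fun _ => c, fun n => by simp [hc, calH_apply_zero]⟩
  | succ m ih =>
    obtain ⟨f, hf, hfg⟩ := hg
    obtain ⟨c, hc⟩ := ih hf
    let v : ℤ → Circle := fun n => g e * ∏ j ∈ Finset.range (m + 1), (tau ^ n).1 (j + 1) (c j)
    have hv : ∀ n, v (n + 1) = f ((t ^ n) e) * v n := by
      intro n
      simp only [v, tau_zpow_add_one_apply_succ, MonoidHom.mul_apply, Finset.prod_mul_distrib, hc]
      exact mul_left_comm _ _ _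
    have hu : ∀ n : ℤ, g ((t ^ (n + 1)) e) = f ((t ^ n) e) * g ((t ^ n) e) := by
      intro n
      rw [add_comm n 1, zpow_one_add]
      exact hfg _
    have huv : ∀ n : ℤ, g ((t ^ n) e) = v n := by
      intro n
      induction n using Int.induction_on with
      | zero => simp [v, calH_one_apply_succ]
      | succ n ih => rw [hu, hv, ih]
      | pred n ih =>
        rw [← sub_add_cancel (-(n : ℤ)) 1, hu, hv] at ih
        exact mul_left_cancel ih
    refine ⟨fun j => Nat.casesOn j (g e) c, fun n => ?_⟩
    rw [huv, Finset.prod_range_succ', mul_comm]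
    simp [v, calH_apply_zero]

/-- A point-transitive system with quasi-discrete spectrum is a factor of `𝓗`. -/
theorem isFactor_calT_of_hasQuasiDiscreteSpectrum {E : Type*} [TopologicalSpace E]
    [CompactSpace E] [T2Space E] {t : E ≃ₜ E} {e : E}
    (he : Dense (Set.range fun n : ℤ => (t ^ n) e)) (h : HasQuasiDiscreteSpectrum t) :
    IsFactor t calT := by
  -- The orbit closure of `(1, e)` turns out to be the graph of the factor map: the orbit formula,
  -- extended to `Z`, makes the first coordinate determine every quasi-eigenfunction at the second.
  let Z : Set (calH × E) := closure (Set.range fun n : ℤ => (tau ^ n, (t ^ n) e))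
  have : CompactSpace Z := isCompact_iff_compactSpace.1 isClosed_closure.isCompact
  have hZ : ∀ n : ℤ, (tau ^ n, (t ^ n) e) ∈ Z := fun n => subset_closure ⟨n, rfl⟩
  let pr : C(Z, calH) := ⟨fun z => z.1.1, continuous_fst.comp continuous_subtype_val⟩
  let pr' : C(Z, E) := ⟨fun z => z.1.2, continuous_snd.comp continuous_subtype_val⟩
  have hprs : Function.Surjective pr := by
    intro ψ
    refine closure_minimal ?_ (isCompact_range pr.continuous).isClosed (dense_zpowers_tau ψ)
    rintro _ ⟨n, rfl⟩
    exact ⟨⟨_, hZ n⟩, rfl⟩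
  have hquot : IsQuotientMap pr := pr.continuous.isClosedMap.isQuotientMap pr.continuous hprs
  have hfac : Function.FactorsThrough pr' pr := by
    rintro ⟨⟨ψ, a⟩, ha⟩ ⟨⟨ψ', b⟩, hb⟩ (rfl : ψ = ψ')
    refine separatesPoints_of_hasQuasiDiscreteSpectrum t h fun m g hg => ?_
    obtain ⟨c, hc⟩ := quasiEigenfunction_orbit t e hg
    have hg' : ∀ z ∈ Z, g z.2 = ∏ j ∈ Finset.range (m + 1), z.1.1 j (c j) := by
      refine (isClosed_eq (by fun_prop) (continuous_finsetProd _ fun j _ =>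
        (continuous_eval_calH j (c j)).comp continuous_fst)).closure_subset_iff.2 ?_
      rintro _ ⟨n, rfl⟩
      exact hc n
    exact (hg' _ ha).trans (hg' _ hb).symm
  let p : C(calH, E) := hquot.lift pr' hfac
  have hp : ∀ n : ℤ, p (tau ^ n) = (t ^ n) e := fun n =>
    DFunLike.congr_fun (hquot.lift_comp pr' hfac) ⟨_, hZ n⟩
  refine ⟨p, p.continuous, fun a => ?_, fun ψ => ?_⟩
  · refine closure_minimal ?_ (isCompact_range p.continuous).isClosed (he a)
    rintro _ ⟨n, rfl⟩
    exact ⟨tau ^ n, hp n⟩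
  · refine (isClosed_eq (p.continuous.comp calT.continuous)
      (t.continuous.comp p.continuous)).closure_subset_iff.2 ?_ (dense_zpowers_tau ψ)
    rintro _ ⟨n, rfl⟩
    change p (calT (tau ^ n)) = t (p (tau ^ n))
    rw [calT_eq_tau_mul, ← zpow_one_add, hp, hp, zpow_one_add]
    rfl

/-! ### The orbit of the identity in `E(X,s)` and evaluation at a point. -/

section Enveloping

variable {X : Type*} [TopologicalSpace X] {s : X ≃ₜ X}

theorem id_mem_envelopingSemigroup : id ∈ envelopingSemigroup s :=
  subset_closure ⟨0, congrArg (DFunLike.coe : (X ≃ₜ X) → X → X) (zpow_zero s)⟩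

theorem envelopingTranslation_zpow_id (n : ℤ) :
    ((envelopingTranslation s ^ n) ⟨id, id_mem_envelopingSemigroup⟩).1 =
      ((s ^ n : X ≃ₜ X) : X → X) := by
  funext x
  exact zpow_apply_of_semiconj (s := envelopingTranslation s) (t := s) (π := fun a => a.1 x)
    (fun a => rfl) n _

theorem dense_orbit_envelopingTranslation :
    Dense (Set.range fun n : ℤ =>
      (envelopingTranslation s ^ n) ⟨id, id_mem_envelopingSemigroup⟩) := by
  rw [Subtype.dense_iff]
  refine closure_mono ?_
  rintro _ ⟨n, rfl⟩
  exact ⟨_, ⟨n, rfl⟩, envelopingTranslation_zpow_id n⟩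

theorem IsMinimal.isFactor_envelopingTranslation [CompactSpace X] [T2Space X]
    (h : IsMinimal s) : IsFactor s (envelopingTranslation s) := by
  obtain ⟨⟨x⟩, h⟩ := h
  have : CompactSpace (envelopingSemigroup s) :=
    isCompact_iff_compactSpace.1 isClosed_closure.isCompact
  have hc : Continuous fun a : envelopingSemigroup s => a.1 x :=
    (continuous_apply x).comp continuous_subtype_val
  refine ⟨fun a => a.1 x, hc, Set.range_eq_univ.1 ?_, fun a => rfl⟩
  refine h _ (isCompact_range hc).isClosed ⟨x, ⟨id, id_mem_envelopingSemigroup⟩, rfl⟩ ?_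
  rw [← Set.range_comp]
  exact (envelopingTranslation s).surjective.range_comp fun a => a.1 x

end Enveloping

end QDS

theorem mainTheorem6 {X : Type*} [TopologicalSpace X] [CompactSpace X] [T2Space X]
    (s : X ≃ₜ X) :
    (QDS.IsFactor s QDS.calT →
      QDS.HasQuasiDiscreteSpectrum (QDS.envelopingTranslation s)) ∧
    (QDS.IsMinimal s →
      (QDS.IsFactor s QDS.calT ↔
        QDS.HasQuasiDiscreteSpectrum (QDS.envelopingTranslation s))) := by
  have h1 := QDS.hasQuasiDiscreteSpectrum_envelopingTranslation_of_isFactor (s := s)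
  have : CompactSpace (QDS.envelopingSemigroup s) :=
    isCompact_iff_compactSpace.1 isClosed_closure.isCompact
  exact ⟨h1, fun hs => ⟨h1, fun h => hs.isFactor_envelopingTranslation.trans
    (QDS.isFactor_calT_of_hasQuasiDiscreteSpectrum QDS.dense_orbit_envelopingTranslation h)⟩⟩
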